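/- **Setting.** Let $V$ be a finite set of vertices; each $v\in V$ carries a random variable $U_v$ with a finite alphabet, and $Q$ is a time-sharing variable with a finite alphabet. A *chain graph representation of an achievable scheme* (CGRAS) on $V$ is given by a transitive irreflexive relation "$v$ is superposed on $u$", by a relation "$v$ is binned against $u$" (no pair $(v,u)$ is in both), and by a subset $B^-$ of the binning relation such that the directed graph with an edge $u\to v$ whenever $v$ is superposed on $u$ or $(v,u)\in B^-$ is acyclic, and such that a binning pair $(v,u)$ is left out of $B^-$ only if the opposite edge $v\to u$ is in this directed graph. Put $\mathrm{sp}(v)=\{u: v\text{ is superposed on }u\}$ and $\mathrm{bp}(v)=\{u:(v,u)\in B^-\}$. Let $\mathbf S_B$ be the set of all vertices that are binned against some vertex. Let $P_{\rm encoding}=P_Q\prod_v P_{U_v|U_{\mathrm{sp}(v)\cup \mathrm{bp}(v)},Q}$ be a joint distribution of $Q$ and $(U_v)_v$ that factorizes in this way, let $P_{\rm codebook}=P_Q\prod_v P_{U_v|U_{\mathrm{sp}(v)},Q}$, where the factors are (arbitrary versions of) the conditional distributions under $P_{\rm encoding}$, and let $$I^{\rm encoding}_{\rm codebook}=\mathbb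 E[\log_2 P_{\rm encoding}]-\mathbb E[\log_2 P_{\rm codebook}],$$ where here and below all expectations and mutual informations are with respect to $P_{\rm encoding}$. *Random code.* Fix message rates $R_v\ge 0$ and binning rates $\bar R_v\ge 0$, with $\bar R_v=0$ for $v\notin \mathbf S_B$. For block length $N$ draw $Q^N$ i.i.d. from $P_Q$. For every $v$ and every choice of message indices $w_u\in[1\ldots 2^{NR_u}]$ and bin indices $b_u\in[1\ldots2^{N\bar R_u}]$ for $u\in\{v\}\cup \mathrm{sp}(v)$, draw a codeword $U_v^N$ with conditionally independent letters from $P_{U_v|U_{\mathrm{sp}(v)},Q}$, given $Q^N$ and the codewords of the vertices in $\mathrm{sp}(v)$ with the same indices. Given the messages $(w_v)_v$, encoding is successful if there are bin indices $(b_v)_v$ such that $Q^N$ and the codewords selected by $(w_v,b_v)_v$ are jointly $\epsilon$-letter typical for $P_{\rm encoding}$, that is, the relative frequency of every letter $a$ differs from $P_{\rm encoding}(a)$ by at most $\epsilon P_{\rm encoding}(a)$. *Information terms.* For $\mathbf S\subseteq \mathbf S_B$ let $I_{\mathbf S}^{\rm M.C.L.}$ be any one of the following three quantities: 1. $\mathbb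 E[\log_2 P_{U_{\mathbf S'}|U_{V\setminus \mathbf S'},Q}]-\mathbb E\big[\log_2\prod_{v\in \mathbf S'}P_{U_v|U_{\mathrm{sp}(v)},Q}\big]$, where $\mathbf S'$ consists of $\mathbf S$ and all vertices superposed on a vertex of $\mathbf S$ (the conditional encoding distribution, respectively codebook distribution, of the codewords that change with the bin indices in $\mathbf S$, given the other codewords); 2. $\mathbb E\Big[\log_2 \frac{P_{\rm encoding}}{\prod_{v\in V\setminus \mathbf S}P_{U_v|U_{\mathrm{sp}(v)\cup \mathrm{bp}(v)},Q}}\Big]-\mathbb E\Big[\log_2 \frac{P_{\rm codebook}}{\prod_{v\in V\setminus \mathbf S}P_{U_v|U_{\mathrm{sp}(v)},Q}}\Big]$; 3. $\sum_{v\in \mathbf S} I\big(U_v;\,U_{\mathrm{bp}(v)\cap \mathbf S}\,\big|\,U_{\mathrm{sp}(v)},\ \{U_u: u\notin \mathbf S,\ u\text{ is binned against }v\},\ Q\big)$. **Theorem 9.** Suppose that for every $\mathbf S\subseteq \mathbf S_B$ that is superposition-closed (if $v\in \mathbf S$ and $w\in \mathbf S_B$ is superposed on $v$, then $w\in \mathbf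 S$) and for which the right-hand side below is positive, $$\sum_{v\in \mathbf S_B\setminus \mathbf S}\bar R_v\;>\;I^{\rm encoding}_{\rm codebook}-I_{\mathbf S}^{\rm M.C.L.}.$$ Then, for every $\epsilon>0$, the probability (over $Q^N$ and the random codebook) that encoding is successful tends to $1$ as $N\to\infty$, uniformly over the messages $(w_v)_v$. -/

import Mathlib

open scoped Classical BigOperators

/-- The graph of a coding scheme that combines superposition coding and binning, together with a
choice of direction for its undirected edges.  The vertices are the auxiliary random variables
`U v` (one per message).

The extra conditions usually put on jointly binned variables (transitivity of joint binning, common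
parents) serve to guarantee that an acyclic orientation exists; they are not imposed here, so every
chain graph representation of an achievable scheme, with any of its acyclic orientations, is
covered. -/
structure CGRAS (V : Type*) where
  /-- `sup v u`: the variable `U v` is superposed on `U u` (a solid edge from `u` to `v`). -/
  sup : V → V → Prop
  /-- `bin v u`: the variable `U v` is binned against `U u` (a dotted edge from `u` to `v`). -/
  bin : V → V → Prop
  /-- The binning edges that are kept in the acyclic directed graph. -/
  orient : V → V → Prop
  sup_irrefl : ∀ v, ¬ sup v v
  sup_trans : ∀ {v u w}, sup v u → sup u w → sup v w
  edges_disjoint : ∀ {v u}, sup v u → ¬ bin v u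
  orient_bin : ∀ {v u}, orient v u → bin v u
  /-- A binning edge is dropped only if the opposite edge is kept. -/
  orient_total : ∀ {v u}, bin v u → orient v u ∨ orient u v ∨ sup u v
  acyclic : ∀ v, ¬ Relation.TransGen (fun x y => sup x y ∨ orient x y) v v

namespace CGRAS

section Graph

variable {V : Type*} [Fintype V]

/-- The vertices on which `v` is superposed. -/
noncomputable def supParents (G : CGRAS V) (v : V) : Finset V :=
  Finset.univ.filter fun u => G.sup v u

/-- The parents of `v` through the oriented binning edges. -/
noncomputable def binParents (G : CGRAS V) (v : V) : Finset V :=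
  Finset.univ.filter fun u => G.orient v u

/-- The vertices which are binned against some other vertex: those carrying a bin index. -/
noncomputable def binned (G : CGRAS V) : Finset V :=
  Finset.univ.filter fun v => ∃ u, G.bin v u

/-- The sets of binned vertices which contain, with a vertex, all binned vertices superposed on
it. -/
def SupClosed (G : CGRAS V) (S : Finset V) : Prop :=
  S ⊆ G.binned ∧ ∀ v ∈ S, ∀ w ∈ G.binned, G.sup w v → w ∈ S

/-- The set `S` together with all vertices (binned or not) superposed on a vertex of `S`: these
are the vertices whose codewords change when all the bin indices in `S` change. -/
noncomputable def above (G : CGRAS V) (S : Finset V) : Finset V :=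
  Finset.univ.filter fun w => w ∈ S ∨ ∃ v ∈ S, G.sup w v

end Graph

/-- The vertex `v` together with the vertices on which it is superposed. -/
abbrev Below {V : Type*} (G : CGRAS V) (v : V) : Type _ :=
  {u : V // u = v ∨ G.sup v u}

end CGRAS

section FiniteLaws

variable {V 𝒬 : Type*} {𝒰 : V → Type*} [Fintype V] [Fintype 𝒬] [∀ v, Fintype (𝒰 v)]

/-- The marginal `P (Q = q, U v = u v for v ∈ A)` of a joint mass function. -/
noncomputable def marginal (p : 𝒬 → (∀ v, 𝒰 v) → ℝ) (A : Finset V) (q : 𝒬)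
    (u : ∀ v, 𝒰 v) : ℝ :=
  ∑ x : ∀ v, 𝒰 v, if ∀ v ∈ A, x v = u v then p q x else 0

/-- The conditional probability `P (U v = u v | Q = q, U w = u w for w ∈ A)`. -/
noncomputable def condMass (p : 𝒬 → (∀ v, 𝒰 v) → ℝ) (v : V) (A : Finset V) (q : 𝒬)
    (u : ∀ v, 𝒰 v) : ℝ :=
  marginal p (insert v A) q u / marginal p A q u

/-- The expectation under a joint mass function. -/
noncomputable def expect (p f : 𝒬 → (∀ v, 𝒰 v) → ℝ) : ℝ :=
  ∑ q : 𝒬, ∑ u : ∀ v, 𝒰 v, p q u * f q u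

/-- The conditional mutual information `I (U_A ; U_B | U_C, Q)` in bits. -/
noncomputable def condMutualInfo (p : 𝒬 → (∀ v, 𝒰 v) → ℝ) (A B C : Finset V) : ℝ :=
  expect p fun q u => Real.logb 2
    (marginal p (A ∪ B ∪ C) q u * marginal p C q u /
      (marginal p (A ∪ C) q u * marginal p (B ∪ C) q u))

end FiniteLaws

/-- The distributions of a coding scheme with graph `G`: the encoding distribution of the
time-sharing variable `Q` and of all `U v`, which factorizes along the superposition edges and the
oriented binning edges, and, for every `v`, a version of its conditional distribution of `U v`
given `Q` and the variables on which `U v` is superposed, from which the codewords are drawn. -/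
structure CodingLaw {V : Type*} [Fintype V] (G : CGRAS V) (𝒬 : Type*) [Fintype 𝒬]
    (𝒰 : V → Type*) [∀ v, Fintype (𝒰 v)] where
  /-- The encoding distribution. -/
  enc : 𝒬 → (∀ v, 𝒰 v) → ℝ
  enc_nonneg : ∀ q u, 0 ≤ enc q u
  enc_sum : ∑ q, ∑ u, enc q u = 1
  enc_factor : ∀ q u, enc q u =
    marginal enc ∅ q u * ∏ v, condMass enc v (G.supParents v ∪ G.binParents v) q u
  /-- The kernels generating the codewords. -/
  gen : ∀ v, 𝒬 → (∀ u : {u : V // G.sup v u}, 𝒰 u) → 𝒰 v → ℝ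
  gen_nonneg : ∀ v q a x, 0 ≤ gen v q a x
  gen_sum : ∀ v q a, ∑ x, gen v q a x = 1
  gen_spec : ∀ v q u, marginal enc (insert v (G.supParents v)) q u =
    marginal enc (G.supParents v) q u * gen v q (fun w => u w) (u v)

namespace CodingLaw

section Information

variable {V : Type*} [Fintype V] {G : CGRAS V} {𝒬 : Type*} [Fintype 𝒬]
  {𝒰 : V → Type*} [∀ v, Fintype (𝒰 v)]

/-- The distribution `P_codebook` of a tuple of codebook letters. -/
noncomputable def codebook (P : CodingLaw G 𝒬 𝒰) (q : 𝒬) (u : ∀ v, 𝒰 v) : ℝ :=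
  marginal P.enc ∅ q u * ∏ v, P.gen v q (fun w => u w) (u v)

/-- `E[log P_encoding] - E[log P_codebook]`, in bits. -/
noncomputable def encodingInfo (P : CodingLaw G 𝒬 𝒰) : ℝ :=
  expect P.enc (fun q u => Real.logb 2 (P.enc q u)) -
    expect P.enc (fun q u => Real.logb 2 (P.codebook q u))

/-- `E[log P_{encoding|Sᶜ}] - E[log P_{codebook|Sᶜ}]`, for the conditional distributions of all
codewords that change with the bin indices in `S`, given the remaining ones: the first one is
conditioned in the encoding distribution, the second one in the codebook distribution. -/
noncomputable def mclConditional (P : CodingLaw G 𝒬 𝒰) (S : Finset V) : ℝ :=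
  expect P.enc (fun q u => Real.logb 2 (P.enc q u / marginal P.enc (G.above S)ᶜ q u)) -
    expect P.enc (fun q u => Real.logb 2 (∏ v ∈ G.above S, P.gen v q (fun w => u w) (u v)))

/-- `E[log P_{encoding|Sᶜ}] - E[log P_{codebook|Sᶜ}]`, where `P_{·|Sᶜ}` is the joint distribution
divided by its factors belonging to the vertices outside `S`. -/
noncomputable def mclRatio (P : CodingLaw G 𝒬 𝒰) (S : Finset V) : ℝ :=
  expect P.enc (fun q u => Real.logb 2
      (P.enc q u / ∏ v ∈ Sᶜ, condMass P.enc v (G.supParents v ∪ G.binParents v) q u)) -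
    expect P.enc (fun q u => Real.logb 2
      (P.codebook q u / ∏ v ∈ Sᶜ, P.gen v q (fun w => u w) (u v)))

/-- The sum over `v ∈ S` of the conditional mutual informations between `U v` and its oriented
binning parents in `S`, given the variables on which `U v` is superposed, the variables outside `S`
which are binned against `U v`, and `Q`. -/
noncomputable def mclSum (P : CodingLaw G 𝒬 𝒰) (S : Finset V) : ℝ :=
  ∑ v ∈ S, condMutualInfo P.enc {v} (G.binParents v ∩ S)
    (G.supParents v ∪ Sᶜ.filter fun u => G.bin u v)

end Information

end CodingLaw

/-- The number of indices in `[1 … 2 ^ (N r)]`. -/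
noncomputable def indexCount (N : ℕ) (r : ℝ) : ℕ := ⌊(2 : ℝ) ^ ((N : ℝ) * r)⌋₊

/-- A pair (message index, bin index) for the vertex `v`. -/
abbrev CodeIndex {V : Type*} (R Rbin : V → ℝ) (N : ℕ) (v : V) : Type :=
  Fin (indexCount N (R v)) × Fin (indexCount N (Rbin v))

/-- A codebook: for every vertex `v`, a word of length `N` for every choice of message and bin
indices of `v` and of the vertices on which `v` is superposed. -/
abbrev Codebook {V : Type*} (G : CGRAS V) (𝒰 : V → Type*) (R Rbin : V → ℝ) (N : ℕ) : Type _ :=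
  ∀ v, (∀ u : G.Below v, CodeIndex R Rbin N u) → Fin N → 𝒰 v

/-- The indices of a codeword of `v` determine those of the codeword of `u` on which it is
superposed. -/
def restrictIndex {V : Type*} (G : CGRAS V) {R Rbin : V → ℝ} {N : ℕ} {v : V}
    (l : ∀ u : G.Below v, CodeIndex R Rbin N u) (u : {u : V // G.sup v u}) :
    ∀ w : G.Below u.1, CodeIndex R Rbin N w :=
  fun w => l ⟨w.1, Or.inr (w.2.elim (fun h => h.symm.subst (motive := G.sup v) u.2)
    fun h => G.sup_trans u.2 h)⟩

section RandomCode

variable {V : Type*} [Fintype V] {G : CGRAS V} {𝒬 : Type*} [Fintype 𝒬]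
  {𝒰 : V → Type*} [∀ v, Fintype (𝒰 v)]

/-- The probability of a time-sharing sequence `q` and a codebook `c`: the letters of `q` are
i.i.d., and given `q` and the codewords on which it is superposed, each codeword has independent
letters drawn from the generating kernel. -/
noncomputable def codebookMass (P : CodingLaw G 𝒬 𝒰) (R Rbin : V → ℝ) (N : ℕ)
    (q : Fin N → 𝒬) (c : Codebook G 𝒰 R Rbin N) : ℝ :=
  (∏ t, ∑ u, P.enc (q t) u) *
    ∏ v, ∏ l : (∀ u : G.Below v, CodeIndex R Rbin N u), ∏ t,
      P.gen v (q t) (fun u => c u (restrictIndex G l u) t) (c v l t)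

/-- Joint letter-typicality: for every letter, the relative frequency differs from the
probability by at most `ε` times the probability. -/
def IsTypical (p : 𝒬 → (∀ v, 𝒰 v) → ℝ) (ε : ℝ) {N : ℕ} (q : Fin N → 𝒬)
    (x : ∀ v, Fin N → 𝒰 v) : Prop :=
  ∀ (a : 𝒬) (u : ∀ v, 𝒰 v),
    |((Finset.univ.filter fun t : Fin N => q t = a ∧ ∀ v, x v t = u v).card : ℝ) / N - p a u|
      ≤ ε * p a u

/-- The codewords of the codebook `c` selected by the messages `m` and the bin indices `b`. -/
def selectedWords {R Rbin : V → ℝ} {N : ℕ} (c : Codebook G 𝒰 R Rbin N)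
    (m : ∀ v, Fin (indexCount N (R v))) (b : ∀ v, Fin (indexCount N (Rbin v))) :
    ∀ v, Fin N → 𝒰 v :=
  fun v => c v fun u => (m u, b u)

/-- The encoding of the messages `m` succeeds: some choice of the bin indices makes the selected
codewords jointly typical with respect to the encoding distribution. -/
def EncodingSucceeds (P : CodingLaw G 𝒬 𝒰) {R Rbin : V → ℝ} {N : ℕ} (ε : ℝ)
    (m : ∀ v, Fin (indexCount N (R v))) (q : Fin N → 𝒬) (c : Codebook G 𝒰 R Rbin N) : Prop :=
  ∃ b : ∀ v, Fin (indexCount N (Rbin v)), IsTypical P.enc ε q (selectedWords c m b)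

/-- The probability, over the time-sharing sequence and the random codebook, that the encoding of
the messages `m` succeeds. -/
noncomputable def successProb (P : CodingLaw G 𝒬 𝒰) (R Rbin : V → ℝ) (N : ℕ) (ε : ℝ)
    (m : ∀ v, Fin (indexCount N (R v))) : ℝ :=
  ∑ q : Fin N → 𝒬, ∑ c : Codebook G 𝒰 R Rbin N,
    if EncodingSucceeds P ε m q c then codebookMass P R Rbin N q c else 0

end RandomCode

/-! ### Summing products of kernels along an acyclic graph. -/

section PartialSums

variable {I : Type*} [Fintype I] [DecidableEq I] {X : I → Type*} [∀ i, Fintype (X i)]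

/-! The proof is a second moment argument with importance weights. Each tuple `b` of bin indices
gets the weight `typicalRatio`: the likelihood ratio of encoding law to codebook law at the selected
words, set to zero off the typical set. Let K be the sum of the weights and M the number of tuples.
If K is nonzero then encoding succeeds, so `sq_sum_le_sum_ite_mul_sum_sq` bounds the success
probability below by (E K)² / E K². The weight converts the codebook law into the encoding law, so
each weight has as its mean the encoding probability of the typical set, which tends to one.

For the second moment, sort pairs `b`, `b'` by the set D on which they differ. Codewords outside
`above D` are shared; those in `above D` are drawn twice, independently given the shared ones
(`sum_codebook_pair`). The correlation is therefore controlled by `sharedRatio D`, the ratio of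
encoding to codebook law of the shared variables. On typical words its product is roughly 2 to the
power N times (`encodingInfo` - `mclConditional S`), where S consists of the binned vertices in
`above D` (`expect_logb_sharedRatio`). For fixed `b`, the fraction of `b'` of type D is at most the
inverse of the number of bin indices outside D, so the rate condition makes the contribution
exponentially small compared with M².

The exception is D equal to the set of all vertices of positive rate: no rate is left outside D.
There the hypothesis forces the information difference to be nonpositive; as it is a relative
entropy, the two laws coincide on the support (equality case of Jensen) and the contribution is at
most M². Hence E K² ≤ (1 + o(1)) M².

The other two information terms are bounded by `mclConditional` on superposition-closed sets, by the
chain rule and because conditioning reduces entropy. Their rate conditions are thus at least as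
strong, and all three cases reduce to one. -/

/-- Summing over the coordinates in `insert a s` means summing over the coordinate `a` and over
those in `s`. -/
theorem sum_agree_insert {s : Finset I} {a : I} (ha : a ∉ s) (c₀ : ∀ i, X i)
    (F : (∀ i, X i) → ℝ) :
    (∑ c : ∀ i, X i, if ∀ j ∉ insert a s, c j = c₀ j then F c else 0) =
      ∑ c : ∀ i, X i, if ∀ j ∉ s, c j = c₀ j then
        ∑ x : X a, F (Function.update c a x) else 0 := by
  rw [← Finset.sum_filter, ← Finset.sum_filter, ← Finset.sum_product']
  refine Finset.sum_bij' (fun c _ => (Function.update c a (c₀ a), c a))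
    (fun z _ => Function.update z.1 a z.2) ?_ ?_ ?_ ?_ ?_
  · intro c hc
    simp only [Finset.mem_filter, Finset.mem_univ, true_and, Finset.mem_product, and_true] at hc ⊢
    intro j hj
    by_cases h : j = a
    · subst h; simp
    · rw [Function.update_of_ne h]
      exact hc j (by simp [h, hj])
  · rintro ⟨c, x⟩ hc
    simp only [Finset.mem_filter, Finset.mem_univ, true_and, Finset.mem_product, and_true] at hc ⊢
    intro j hj
    rw [Finset.mem_insert, not_or] at hj
    rw [Function.update_of_ne hj.1]
    exact hc j hj.2
  · intro c _
    simp
  · rintro ⟨c, x⟩ hc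
    simp only [Finset.mem_filter, Finset.mem_univ, true_and, Finset.mem_product, and_true] at hc
    simp [← hc a ha]
  · intro c _
    simp

/-- A product of conditional mass functions along an acyclic graph sums to one over any set of
coordinates, whatever the other coordinates are. -/
theorem sum_prod_kernel_eq_one (K : ∀ _ : I, (∀ j, X j) → ℝ) (r : I → ℕ)
    (hK : ∀ i c c', (∀ j, r j < r i → c j = c' j) → c i = c' i → K i c = K i c')
    (h1 : ∀ i c, ∑ x, K i (Function.update c i x) = 1) (T : Finset I) (c₀ : ∀ i, X i) :
    (∑ c : ∀ i, X i, if ∀ j ∉ T, c j = c₀ j then ∏ i ∈ T, K i c else 0) = 1 := by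
  -- A coordinate of largest rank occurs in no other factor of the product, so its kernel can be
  -- summed out first.
  induction T using Finset.induction_on_max_value r with
  | empty =>
    simp_rw [show ∀ c : ∀ i, X i, (∀ j ∉ (∅ : Finset I), c j = c₀ j) ↔ c = c₀ from fun c => by
      simp [funext_iff]]
    simp
  | insert a s ha hr ih =>
    rw [sum_agree_insert ha, ← ih]
    refine Finset.sum_congr rfl fun c _ => ?_
    split_ifs with hc
    swap
    · rfl
    have hs : ∀ x, ∏ i ∈ s, K i (Function.update c a x) = ∏ i ∈ s, K i c := fun x =>
      Finset.prod_congr rfl fun i hi => hK i _ _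
        (fun j hj => Function.update_of_ne (by rintro rfl; exact absurd (hr i hi) (by omega)) _ _)
        (Function.update_of_ne (by rintro rfl; exact ha hi) _ _)
    simp_rw [Finset.prod_insert ha, hs, ← Finset.sum_mul, h1, one_mul]

end PartialSums

/-! ### Marginals of a joint mass function. -/

section Marginals

variable {V 𝒬 : Type*} {𝒰 : V → Type*} [Fintype V] [∀ v, Fintype (𝒰 v)]
  {p : 𝒬 → (∀ v, 𝒰 v) → ℝ}

theorem marginal_congr (p : 𝒬 → (∀ v, 𝒰 v) → ℝ) {A : Finset V} {q : 𝒬} {u u' : ∀ v, 𝒰 v}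
    (h : ∀ v ∈ A, u v = u' v) : marginal p A q u = marginal p A q u' := by
  unfold marginal
  refine Finset.sum_congr rfl fun x _ => if_congr ?_ rfl rfl
  exact forall₂_congr fun v hv => by rw [h v hv]

theorem marginal_univ (q : 𝒬) (u : ∀ v, 𝒰 v) : marginal p Finset.univ q u = p q u := by
  unfold marginal
  simp_rw [show ∀ x : ∀ v, 𝒰 v, (∀ v ∈ Finset.univ, x v = u v) ↔ x = u from fun x => by
    simp [funext_iff]]
  simp

theorem marginal_empty (q : 𝒬) (u : ∀ v, 𝒰 v) : marginal p ∅ q u = ∑ x, p q x := by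
  simp [marginal]

theorem marginal_nonneg (hp : ∀ q u, 0 ≤ p q u) (A : Finset V) (q : 𝒬) (u : ∀ v, 𝒰 v) :
    0 ≤ marginal p A q u :=
  Finset.sum_nonneg fun x _ => by split_ifs; exacts [hp q x, le_rfl]

theorem le_marginal (hp : ∀ q u, 0 ≤ p q u) (A : Finset V) (q : 𝒬) (u : ∀ v, 𝒰 v) :
    p q u ≤ marginal p A q u := by
  have := Finset.single_le_sum (f := fun x : ∀ v, 𝒰 v => if ∀ v ∈ A, x v = u v then p q x else 0)
    (fun x _ => by split_ifs; exacts [hp q x, le_rfl]) (Finset.mem_univ u)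
  simpa [marginal] using this

theorem marginal_pos (hp : ∀ q u, 0 ≤ p q u) (A : Finset V) {q : 𝒬} {u : ∀ v, 𝒰 v}
    (h : 0 < p q u) : 0 < marginal p A q u :=
  h.trans_le (le_marginal hp A q u)

theorem sum_marginal_insert (p : 𝒬 → (∀ v, 𝒰 v) → ℝ) {A : Finset V} {v : V} (hv : v ∉ A) (q : 𝒬)
    (u : ∀ v, 𝒰 v) :
    ∑ x : 𝒰 v, marginal p (insert v A) q (Function.update u v x) = marginal p A q u := by
  unfold marginal
  rw [Finset.sum_comm]
  refine Finset.sum_congr rfl fun y _ => ?_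
  have : ∀ x, (∀ w ∈ insert v A, y w = Function.update u v x w) ↔
      (x = y v ∧ ∀ w ∈ A, y w = u w) := fun x => by
    rw [Finset.forall_mem_insert, Function.update_self, eq_comm]
    refine and_congr Iff.rfl (forall₂_congr fun w hw => ?_)
    rw [Function.update_of_ne (by rintro rfl; exact hv hw)]
  simp_rw [this, ite_and]
  simp

/-- Every tuple agrees on `A` with exactly one tuple that agrees with `u₀` off `A`. -/
theorem sum_agree_ite (A : Finset V) (x u₀ : ∀ v, 𝒰 v) (a : ℝ) :
    (∑ u : ∀ v, 𝒰 v, if ∀ v ∉ A, u v = u₀ v then (if ∀ v ∈ A, x v = u v then a else 0) else 0) =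
      a := by
  have : ∀ u : ∀ v, 𝒰 v, ((∀ v ∉ A, u v = u₀ v) ∧ ∀ v ∈ A, x v = u v) ↔ u = A.piecewise x u₀ := by
    intro u
    rw [funext_iff]
    constructor
    · rintro ⟨h1, h2⟩ v
      by_cases hv : v ∈ A
      · simp [hv, h2 v hv]
      · simp [hv, h1 v hv]
    · intro h
      refine ⟨fun v hv => ?_, fun v hv => ?_⟩
      · simp [h v, hv]
      · simp [h v, hv]
  simp_rw [← ite_and, this]
  simp

theorem sum_agree_marginal (A : Finset V) (q : 𝒬) (u₀ : ∀ v, 𝒰 v) :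
    (∑ u : ∀ v, 𝒰 v, if ∀ v ∉ A, u v = u₀ v then marginal p A q u else 0) = ∑ x, p q x := by
  unfold marginal
  calc _ = ∑ x : ∀ v, 𝒰 v, ∑ u : ∀ v, 𝒰 v,
        if ∀ v ∉ A, u v = u₀ v then (if ∀ v ∈ A, x v = u v then p q x else 0) else 0 := by
        rw [Finset.sum_comm]
        refine Finset.sum_congr rfl fun u _ => ?_
        split_ifs <;> simp
    _ = _ := Finset.sum_congr rfl fun x _ => sum_agree_ite A x u₀ _

/-- A change of measure: dividing by the `A`-marginal turns an expectation of a function of the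
`A`-coordinates into a plain sum over them. Only an inequality holds, because tuples with vanishing
marginal are lost on the left (division by zero gives zero). -/
theorem sum_mul_div_marginal_le (hp : ∀ q u, 0 ≤ p q u) (A : Finset V) (q : 𝒬)
    (g : (∀ v, 𝒰 v) → ℝ) (hg : ∀ u, 0 ≤ g u)
    (hg' : ∀ u u', (∀ v ∈ A, u v = u' v) → g u = g u') (u₀ : ∀ v, 𝒰 v) :
    ∑ u, p q u * (g u / marginal p A q u) ≤
      ∑ u, if ∀ v ∉ A, u v = u₀ v then g u else 0 := by
  calc ∑ u, p q u * (g u / marginal p A q u)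
      = ∑ x : ∀ v, 𝒰 v, ∑ u : ∀ v, 𝒰 v, if ∀ v ∉ A, u v = u₀ v then
          (if ∀ v ∈ A, x v = u v then p q x * (g x / marginal p A q x) else 0) else 0 :=
        Finset.sum_congr rfl fun x _ => (sum_agree_ite A x u₀ _).symm
    _ = ∑ u : ∀ v, 𝒰 v, if ∀ v ∉ A, u v = u₀ v then
          marginal p A q u * (g u / marginal p A q u) else 0 := by
        rw [Finset.sum_comm]
        refine Finset.sum_congr rfl fun u _ => ?_
        split_ifs
        swap
        · simp
        conv_rhs => rw [marginal, Finset.sum_mul]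
        refine Finset.sum_congr rfl fun x _ => ?_
        split_ifs with h
        · rw [hg' x u h, marginal_congr p h, marginal]
        · simp
    _ ≤ _ := by
        refine Finset.sum_le_sum fun u _ => ?_
        split_ifs
        swap
        · rfl
        rcases (marginal_nonneg hp A q u).eq_or_lt with h | h
        · rw [← h]; simpa using hg u
        · rw [mul_div_cancel₀ _ h.ne']

end Marginals

/-! ### Jensen's inequality and conditional entropy. -/

section Expectations

variable {V 𝒬 : Type*} {𝒰 : V → Type*} [Fintype V] [Fintype 𝒬] [∀ v, Fintype (𝒰 v)]
  {p : 𝒬 → (∀ v, 𝒰 v) → ℝ}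

theorem expect_congr {f g : 𝒬 → (∀ v, 𝒰 v) → ℝ} (hp : ∀ q u, 0 ≤ p q u)
    (h : ∀ q u, 0 < p q u → f q u = g q u) : expect p f = expect p g := by
  refine Finset.sum_congr rfl fun q _ => Finset.sum_congr rfl fun u _ => ?_
  rcases (hp q u).eq_or_lt with h0 | h0
  · simp [← h0]
  · rw [h q u h0]

theorem expect_add (f g : 𝒬 → (∀ v, 𝒰 v) → ℝ) :
    expect p (fun q u => f q u + g q u) = expect p f + expect p g := by
  simp only [expect, mul_add, Finset.sum_add_distrib]

theorem expect_sub (f g : 𝒬 → (∀ v, 𝒰 v) → ℝ) :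
    expect p (fun q u => f q u - g q u) = expect p f - expect p g := by
  simp only [expect, mul_sub, Finset.sum_sub_distrib]

theorem expect_finset_sum {ι : Type*} (s : Finset ι) (f : ι → 𝒬 → (∀ v, 𝒰 v) → ℝ) :
    expect p (fun q u => ∑ i ∈ s, f i q u) = ∑ i ∈ s, expect p (f i) := by
  induction s using Finset.induction_on with
  | empty => simp [expect]
  | insert a s ha ih => simp_rw [Finset.sum_insert ha, expect_add, ih]

/-- Jensen's inequality for the logarithm. -/
theorem expect_logb_nonpos (hp : ∀ q u, 0 ≤ p q u) (hp1 : ∑ q, ∑ u, p q u = 1)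
    {f : 𝒬 → (∀ v, 𝒰 v) → ℝ} (hf : ∀ q u, 0 < p q u → 0 < f q u)
    (hs : ∑ q, ∑ u, p q u * f q u ≤ 1) : expect p (fun q u => Real.logb 2 (f q u)) ≤ 0 := by
  have h2 : 0 < Real.log 2 := Real.log_pos one_lt_two
  have : expect p (fun q u => Real.logb 2 (f q u)) * Real.log 2 ≤
      ∑ q, ∑ u, (p q u * f q u - p q u) := by
    simp only [expect, Finset.sum_mul]
    refine Finset.sum_le_sum fun q _ => Finset.sum_le_sum fun u _ => ?_
    rcases (hp q u).eq_or_lt with h0 | h0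
    · simp [← h0]
    · rw [Real.logb, mul_assoc, div_mul_cancel₀ _ h2.ne']
      nlinarith [Real.log_le_sub_one_of_pos (hf q u h0)]
  simp only [Finset.sum_sub_distrib, hp1] at this
  by_contra! h
  nlinarith [mul_pos h h2]

/-- The case of equality in Jensen's inequality for the logarithm. -/
theorem eq_one_of_expect_logb_nonneg (hp : ∀ q u, 0 ≤ p q u) (hp1 : ∑ q, ∑ u, p q u = 1)
    {f : 𝒬 → (∀ v, 𝒰 v) → ℝ} (hf : ∀ q u, 0 < p q u → 0 < f q u)
    (hs : ∑ q, ∑ u, p q u * f q u ≤ 1) (h : 0 ≤ expect p (fun q u => Real.logb 2 (f q u)))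
    {q : 𝒬} {u : ∀ v, 𝒰 v} (hqu : 0 < p q u) : f q u = 1 := by
  have h2 : 0 < Real.log 2 := Real.log_pos one_lt_two
  by_contra hne
  have hle : ∀ q u, p q u * Real.logb 2 (f q u) * Real.log 2 ≤ p q u * f q u - p q u := by
    intro q u
    rcases (hp q u).eq_or_lt with h0 | h0
    · simp [← h0]
    · rw [Real.logb, mul_assoc, div_mul_cancel₀ _ h2.ne']
      nlinarith [Real.log_le_sub_one_of_pos (hf q u h0)]
  have hlt : p q u * Real.logb 2 (f q u) * Real.log 2 < p q u * f q u - p q u := by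
    rw [Real.logb, mul_assoc, div_mul_cancel₀ _ h2.ne']
    nlinarith [Real.log_lt_sub_one_of_pos (hf q u hqu) hne]
  have : expect p (fun q u => Real.logb 2 (f q u)) * Real.log 2 <
      ∑ q, ∑ u, (p q u * f q u - p q u) := by
    simp only [expect, Finset.sum_mul]
    exact Finset.sum_lt_sum (fun q _ => Finset.sum_le_sum fun u _ => hle q u)
      ⟨q, Finset.mem_univ _, Finset.sum_lt_sum (fun u _ => hle q u) ⟨u, Finset.mem_univ _, hlt⟩⟩
  simp only [Finset.sum_sub_distrib, hp1] at this
  nlinarith [mul_nonneg h h2.le]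

/-- The expected logarithm of a marginal, that is, minus the joint entropy. -/
noncomputable def negEntropy (p : 𝒬 → (∀ v, 𝒰 v) → ℝ) (A : Finset V) : ℝ :=
  expect p fun q u => Real.logb 2 (marginal p A q u)

/-- Conditioning reduces entropy. -/
theorem negEntropy_insert_sub_mono (hp : ∀ q u, 0 ≤ p q u) (hp1 : ∑ q, ∑ u, p q u = 1)
    {A B : Finset V} (hAB : A ⊆ B) {v : V} (hv : v ∉ B) :
    negEntropy p (insert v A) - negEntropy p A ≤ negEntropy p (insert v B) - negEntropy p B := by
  have hvA : v ∉ A := fun h => hv (hAB h)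
  -- Jensen is applied to P_B · P_{v|A} / P_{B ∪ v}. Its numerator has total mass at most one over
  -- the coordinates `insert v B`, since `v` can be summed out of the conditional factor.
  have hpos : ∀ q u, 0 < p q u →
      0 < marginal p B q u * (marginal p (insert v A) q u / marginal p A q u) /
        marginal p (insert v B) q u := fun q u h => by
    have := fun A : Finset V => marginal_pos hp A h
    have h1 := this A; have h2 := this B; have h3 := this (insert v A); have h4 := this (insert v B)
    positivity
  have key := expect_logb_nonpos hp hp1 hpos ?_
  · rw [expect_congr (g := fun q u => (Real.logb 2 (marginal p B q u) +
      (Real.logb 2 (marginal p (insert v A) q u) - Real.logb 2 (marginal p A q u))) -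
        Real.logb 2 (marginal p (insert v B) q u)) hp] at key
    · rw [expect_sub, expect_add, expect_sub] at key
      unfold negEntropy
      linarith
    · intro q u h
      have := fun A : Finset V => (marginal_pos hp A h).ne'
      rw [Real.logb_div (mul_ne_zero (this _) (div_ne_zero (this _) (this _))) (this _),
        Real.logb_mul (this _) (div_ne_zero (this _) (this _)), Real.logb_div (this _) (this _)]
  · rw [← hp1]
    refine Finset.sum_le_sum fun q _ => ?_
    rcases isEmpty_or_nonempty (∀ v, 𝒰 v) with hE | ⟨⟨u₀⟩⟩
    · simp
    have hnn := fun A : Finset V => marginal_nonneg hp A q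
    refine (sum_mul_div_marginal_le hp (insert v B) q
      (fun u => marginal p B q u * (marginal p (insert v A) q u / marginal p A q u))
      (fun u => mul_nonneg (hnn _ u) (div_nonneg (hnn _ u) (hnn _ u))) ?_ u₀).trans ?_
    · intro u u' h
      have hB : ∀ w ∈ B, u w = u' w := fun w hw => h w (Finset.mem_insert_of_mem hw)
      rw [marginal_congr p hB, marginal_congr p fun w hw => hB w (hAB hw),
        marginal_congr p fun w hw => h w (Finset.insert_subset_insert v hAB hw)]
    · rw [sum_agree_insert hv, ← sum_agree_marginal B q u₀]
      refine Finset.sum_le_sum fun u _ => ?_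
      split_ifs
      swap
      · rfl
      have hc : ∀ C : Finset V, v ∉ C → ∀ x,
          marginal p C q (Function.update u v x) = marginal p C q u := fun C hC x =>
        marginal_congr p fun w hw => Function.update_of_ne (by rintro rfl; exact hC hw) _ _
      simp_rw [hc B hv, hc A hvA, ← Finset.mul_sum, ← Finset.sum_div, sum_marginal_insert p hvA]
      exact mul_le_of_le_one_right (hnn _ u) (div_self_le_one _)

/-- A lower bound on the joint conditional (negative) entropy by a sum over single variables, each
conditioned on variables that come earlier. -/
theorem sum_negEntropy_insert_sub_le (hp : ∀ q u, 0 ≤ p q u) (hp1 : ∑ q, ∑ u, p q u = 1)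
    (r : V → ℕ) (C : Finset V) (A : V → Finset V) (T : Finset V) (hCT : Disjoint C T)
    (hA : ∀ v ∈ T, ∀ w ∈ A v, w ∈ C ∨ (w ∈ T ∧ r w < r v)) :
    ∑ v ∈ T, (negEntropy p (insert v (A v)) - negEntropy p (A v)) ≤
      negEntropy p (C ∪ T) - negEntropy p C := by
  induction T using Finset.induction_on_max_value r with
  | empty => simp
  | insert a s ha hr ih =>
    rw [Finset.disjoint_insert_right] at hCT
    have h1 := ih hCT.2 fun v hv w hw => by
      rcases hA v (Finset.mem_insert_of_mem hv) w hw with h | ⟨h, h'⟩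
      · exact Or.inl h
      · rcases Finset.mem_insert.1 h with rfl | h
        · exact absurd (hr v hv) (by omega)
        · exact Or.inr ⟨h, h'⟩
    -- Chain rule: the vertex of largest rank is peeled off last, and enlarging its conditioning set
    -- from `A a` to everything before it only raises its term.
    have h2 := negEntropy_insert_sub_mono hp hp1 (A := A a) (B := C ∪ s) (v := a) (fun w hw => by
      rcases hA a (Finset.mem_insert_self _ _) w hw with h | ⟨h, h'⟩
      · exact Finset.mem_union_left _ h
      · rcases Finset.mem_insert.1 h with rfl | h
        · omega
        · exact Finset.mem_union_right _ h) (by simp [hCT.1, ha])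
    rw [Finset.sum_insert ha, Finset.union_insert]
    linarith

end Expectations

/-! ### Ranks and superposition closures in the graph. -/

namespace CGRAS

variable {V : Type*} (G : CGRAS V)

/-- The rank counts the vertices reachable along directed parents. A parent `u` of `v` reaches only
what `v` reaches, and by acyclicity not itself, so its count is strictly smaller. -/
theorem exists_rank [Fintype V] :
    ∃ r : V → ℕ, ∀ v u, G.sup v u ∨ G.orient v u → r u < r v := by
  let E : V → V → Prop := fun x y => G.sup x y ∨ G.orient x y
  refine ⟨fun v => (Finset.univ.filter fun u => Relation.TransGen E v u).card, fun v u h => ?_⟩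
  refine Finset.card_lt_card ((Finset.ssubset_iff_of_subset fun w hw => ?_).2 ⟨u, ?_, ?_⟩)
  · simp only [Finset.mem_filter, Finset.mem_univ, true_and] at hw ⊢
    exact Relation.TransGen.head h hw
  · simpa using Relation.TransGen.single (r := E) h
  · simpa using G.acyclic u

variable {G} [Fintype V]

theorem mem_above {S : Finset V} {w : V} : w ∈ G.above S ↔ w ∈ S ∨ ∃ v ∈ S, G.sup w v := by
  simp [above]

theorem subset_above (S : Finset V) : S ⊆ G.above S := fun _ h => mem_above.2 (Or.inl h)

theorem mem_above_of_sup {S : Finset V} {v w : V} (hv : v ∈ G.above S) (h : G.sup w v) :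
    w ∈ G.above S := by
  rcases mem_above.1 hv with hv | ⟨x, hx, hvx⟩
  · exact mem_above.2 (Or.inr ⟨v, hv, h⟩)
  · exact mem_above.2 (Or.inr ⟨x, hx, G.sup_trans h hvx⟩)

theorem not_mem_above_of_sup {S : Finset V} {v w : V} (hv : v ∉ G.above S) (h : G.sup v w) :
    w ∉ G.above S :=
  fun hw => hv (mem_above_of_sup hw h)

/-- Sets on which two bin index tuples differ need not be superposition-closed. This is the closed
set at which the rate hypothesis is used instead; the next lemma shows that the same codewords
change. -/
theorem supClosed_above_inter_binned (D : Finset V) : G.SupClosed (G.above D ∩ G.binned) := by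
  refine ⟨Finset.inter_subset_right, fun v hv w hw h => ?_⟩
  exact Finset.mem_inter.2 ⟨mem_above_of_sup (Finset.mem_inter.1 hv).1 h, hw⟩

theorem above_above_inter_binned {D : Finset V} (hD : D ⊆ G.binned) :
    G.above (G.above D ∩ G.binned) = G.above D := by
  refine Finset.Subset.antisymm (fun w hw => ?_) fun w hw => ?_
  · rcases mem_above.1 hw with h | ⟨v, hv, h⟩
    · exact (Finset.mem_inter.1 h).1
    · exact mem_above_of_sup (Finset.mem_inter.1 hv).1 h
  · have hsub : D ⊆ G.above D ∩ G.binned := Finset.subset_inter (subset_above D) hD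
    rcases mem_above.1 hw with h | ⟨v, hv, h⟩
    · exact subset_above _ (hsub h)
    · exact mem_above.2 (Or.inr ⟨v, hsub hv, h⟩)

theorem mem_supParents {v u : V} : u ∈ G.supParents v ↔ G.sup v u := by simp [supParents]

theorem mem_binParents {v u : V} : u ∈ G.binParents v ↔ G.orient v u := by simp [binParents]

end CGRAS

/-! ### Comparison of the three information terms. -/

namespace CodingLaw

variable {V : Type*} [Fintype V] {G : CGRAS V} {𝒬 : Type*} [Fintype 𝒬]
  {𝒰 : V → Type*} [∀ v, Fintype (𝒰 v)] (P : CodingLaw G 𝒬 𝒰)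

/-- On the support of the encoding law the kernels do not vanish, so the logarithms and likelihood
ratios below are genuine there. -/
theorem gen_pos {q : 𝒬} {u : ∀ v, 𝒰 v} (h : 0 < P.enc q u) (v : V) :
    0 < P.gen v q (fun w => u w) (u v) := by
  have h1 := marginal_pos P.enc_nonneg (insert v (G.supParents v)) h
  rw [P.gen_spec] at h1
  exact pos_of_mul_pos_right h1 (marginal_nonneg P.enc_nonneg _ _ _)

theorem expect_logb_gen (v : V) :
    expect P.enc (fun q u => Real.logb 2 (P.gen v q (fun w => u w) (u v))) =
      negEntropy P.enc (insert v (G.supParents v)) - negEntropy P.enc (G.supParents v) := by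
  unfold negEntropy
  rw [← expect_sub]
  refine expect_congr P.enc_nonneg fun q u h => ?_
  rw [P.gen_spec, Real.logb_mul (marginal_pos P.enc_nonneg _ h).ne' (P.gen_pos h v).ne']
  ring

theorem expect_logb_prod_gen (T : Finset V) :
    expect P.enc (fun q u => Real.logb 2 (∏ v ∈ T, P.gen v q (fun w => u w) (u v))) =
      ∑ v ∈ T, (negEntropy P.enc (insert v (G.supParents v)) -
        negEntropy P.enc (G.supParents v)) := by
  simp_rw [← P.expect_logb_gen]
  rw [← expect_finset_sum]
  exact expect_congr P.enc_nonneg fun q u h => Real.logb_prod _ _ fun v _ => (P.gen_pos h v).ne'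

theorem condMass_pos {q : 𝒬} {u : ∀ v, 𝒰 v} (h : 0 < P.enc q u) (v : V) (A : Finset V) :
    0 < condMass P.enc v A q u :=
  div_pos (marginal_pos P.enc_nonneg _ h) (marginal_pos P.enc_nonneg _ h)

theorem expect_logb_prod_condMass (T : Finset V) (A : V → Finset V) :
    expect P.enc (fun q u => Real.logb 2 (∏ v ∈ T, condMass P.enc v (A v) q u)) =
      ∑ v ∈ T, (negEntropy P.enc (insert v (A v)) - negEntropy P.enc (A v)) := by
  unfold negEntropy
  simp_rw [← expect_sub]
  rw [← expect_finset_sum]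
  refine expect_congr P.enc_nonneg fun q u h => ?_
  rw [Real.logb_prod _ _ fun v _ => (P.condMass_pos h v _).ne']
  refine Finset.sum_congr rfl fun v _ => ?_
  rw [condMass, Real.logb_div (marginal_pos P.enc_nonneg _ h).ne'
    (marginal_pos P.enc_nonneg _ h).ne']

theorem mclConditional_eq (S : Finset V) :
    P.mclConditional S = negEntropy P.enc Finset.univ - negEntropy P.enc (G.above S)ᶜ -
      ∑ v ∈ G.above S, (negEntropy P.enc (insert v (G.supParents v)) -
        negEntropy P.enc (G.supParents v)) := by
  rw [mclConditional, expect_logb_prod_gen]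
  congr 1
  unfold negEntropy
  rw [← expect_sub]
  refine expect_congr P.enc_nonneg fun q u h => ?_
  rw [marginal_univ, Real.logb_div h.ne' (marginal_pos P.enc_nonneg _ h).ne']

theorem mclRatio_eq (S : Finset V) :
    P.mclRatio S = ∑ v ∈ S, (negEntropy P.enc (insert v (G.supParents v ∪ G.binParents v)) -
        negEntropy P.enc (G.supParents v ∪ G.binParents v)) -
      ∑ v ∈ S, (negEntropy P.enc (insert v (G.supParents v)) -
        negEntropy P.enc (G.supParents v)) := by
  rw [← expect_logb_prod_gen, ← P.expect_logb_prod_condMass S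
    (fun v => G.supParents v ∪ G.binParents v), mclRatio, ← expect_sub, ← expect_sub]
  refine expect_congr P.enc_nonneg fun q u h => ?_
  have hm := (marginal_pos P.enc_nonneg ∅ h).ne'
  have hc : ∀ T : Finset V,
      ∏ v ∈ T, condMass P.enc v (G.supParents v ∪ G.binParents v) q u ≠ 0 := fun T =>
    Finset.prod_ne_zero_iff.2 fun v _ => (P.condMass_pos h v _).ne'
  have hg : ∀ T : Finset V, ∏ v ∈ T, P.gen v q (fun w => u w) (u v) ≠ 0 := fun T =>
    Finset.prod_ne_zero_iff.2 fun v _ => (P.gen_pos h v).ne'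
  rw [codebook, P.enc_factor, ← Finset.prod_mul_prod_compl S,
    ← Finset.prod_mul_prod_compl S fun v => P.gen v q (fun w => u w) (u v), ← mul_assoc,
    ← mul_assoc, mul_div_cancel_right₀ _ (hc _), mul_div_cancel_right₀ _ (hg _),
    Real.logb_mul hm (hc _), Real.logb_mul hm (hg _)]
  ring

theorem mclSum_eq (S : Finset V) :
    P.mclSum S = ∑ v ∈ S,
      ((negEntropy P.enc (insert v (G.binParents v ∩ S ∪
          (G.supParents v ∪ Sᶜ.filter fun u => G.bin u v))) -
        negEntropy P.enc (G.binParents v ∩ S ∪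
          (G.supParents v ∪ Sᶜ.filter fun u => G.bin u v))) -
      (negEntropy P.enc (insert v (G.supParents v ∪ Sᶜ.filter fun u => G.bin u v)) -
        negEntropy P.enc (G.supParents v ∪ Sᶜ.filter fun u => G.bin u v))) := by
  refine Finset.sum_congr rfl fun v _ => ?_
  unfold negEntropy condMutualInfo
  simp_rw [← expect_sub]
  refine expect_congr P.enc_nonneg fun q u h => ?_
  have hm := fun A : Finset V => (marginal_pos P.enc_nonneg A h).ne'
  rw [Real.logb_div (mul_ne_zero (hm _) (hm _)) (mul_ne_zero (hm _) (hm _)),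
    Real.logb_mul (hm _) (hm _), Real.logb_mul (hm _) (hm _), Finset.union_assoc,
    ← Finset.insert_eq, ← Finset.insert_eq]
  ring

/-- The chain rule over `above S`, with vertices of `above S \ S` conditioned only on their
superposition parents: their encoding terms then equal their codebook terms and cancel. Both other
information terms are compared with `mclConditional` through this bound. -/
theorem sum_condInfo_le_mclConditional {S : Finset V} (A : V → Finset V) (r : V → ℕ)
    (hr : ∀ v u, G.sup v u ∨ G.orient v u → r u < r v)
    (hA : ∀ v ∈ S, ∀ w ∈ A v, w ∈ (G.above S)ᶜ ∨ r w < r v) :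
    ∑ v ∈ S, (negEntropy P.enc (insert v (A v)) - negEntropy P.enc (A v)) -
      ∑ v ∈ S, (negEntropy P.enc (insert v (G.supParents v)) -
        negEntropy P.enc (G.supParents v)) ≤ P.mclConditional S := by
  have key := sum_negEntropy_insert_sub_le P.enc_nonneg P.enc_sum r (G.above S)ᶜ
    (fun v => if v ∈ S then A v else G.supParents v) (G.above S) disjoint_compl_left
    (fun v hv w hw => by
      by_cases hwT : w ∈ G.above S
      · refine Or.inr ⟨hwT, ?_⟩
        split_ifs at hw with hvS
        · exact (hA v hvS w hw).resolve_left (by simpa using hwT)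
        · exact hr v w (Or.inl (CGRAS.mem_supParents.1 hw))
      · exact Or.inl (by simpa using hwT))
  rw [mclConditional_eq]
  rw [Finset.union_comm, Finset.union_compl] at key
  have hsub := CGRAS.subset_above (G := G) S
  rw [← Finset.sum_sdiff hsub] at key ⊢
  rw [Finset.sum_congr rfl fun v (hv : v ∈ G.above S \ S) => by
      rw [if_neg (Finset.mem_sdiff.1 hv).2],
    Finset.sum_congr (s₁ := S) rfl fun v (hv : v ∈ S) => by rw [if_pos hv]] at key
  linarith

theorem mclRatio_le_mclConditional (S : Finset V) : P.mclRatio S ≤ P.mclConditional S := by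
  obtain ⟨r, hr⟩ := G.exists_rank
  rw [mclRatio_eq]
  refine P.sum_condInfo_le_mclConditional _ r hr fun v _ w hw => Or.inr (hr v w ?_)
  rcases Finset.mem_union.1 hw with h | h
  · exact Or.inl (CGRAS.mem_supParents.1 h)
  · exact Or.inr (CGRAS.mem_binParents.1 h)

/-- Replacing the subtracted conditional entropy term by the one given the superposition parents
alone only enlarges the sum; the general bound then applies. -/
theorem mclSum_le_mclConditional {S : Finset V} (hS : G.SupClosed S) :
    P.mclSum S ≤ P.mclConditional S := by
  obtain ⟨r, hr⟩ := G.exists_rank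
  -- Superposition-closedness enters here: a vertex binned against `v` is itself binned, so if it
  -- were superposed on a vertex of `S` it would belong to `S`.
  have hout : ∀ v ∈ S, ∀ w ∈ Sᶜ.filter (fun u => G.bin u v), w ∉ G.above S := by
    intro v _ w hw h
    simp only [Finset.mem_filter, Finset.mem_compl] at hw
    rcases CGRAS.mem_above.1 h with h | ⟨x, hx, h⟩
    · exact hw.1 h
    · exact hw.1 (hS.2 x hx w (by simpa [CGRAS.binned] using ⟨v, hw.2⟩) h)
  refine le_trans ?_ (P.sum_condInfo_le_mclConditional
    (fun v => G.binParents v ∩ S ∪ (G.supParents v ∪ Sᶜ.filter fun u => G.bin u v)) r hr ?_)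
  · rw [mclSum_eq, ← Finset.sum_sub_distrib]
    refine Finset.sum_le_sum fun v hv => sub_le_sub_left ?_ _
    refine negEntropy_insert_sub_mono P.enc_nonneg P.enc_sum Finset.subset_union_left ?_
    simp [hv, CGRAS.mem_supParents, G.sup_irrefl]
  · intro v hv w hw
    simp only [Finset.mem_union] at hw
    rcases hw with h | h | h
    · exact Or.inr (hr v w (Or.inr (CGRAS.mem_binParents.1 (Finset.mem_inter.1 h).1)))
    · exact Or.inr (hr v w (Or.inl (CGRAS.mem_supParents.1 h)))
    · exact Or.inl (Finset.mem_compl.2 (hout v hv w h))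

/-- The part of the codebook distribution belonging to `Q` and the vertices in `A`. -/
noncomputable def codebookOn (A : Finset V) (q : 𝒬) (u : ∀ v, 𝒰 v) : ℝ :=
  marginal P.enc ∅ q u * ∏ v ∈ A, P.gen v q (fun w => u w) (u v)

theorem codebookOn_nonneg (A : Finset V) (q : 𝒬) (u : ∀ v, 𝒰 v) : 0 ≤ P.codebookOn A q u :=
  mul_nonneg (marginal_nonneg P.enc_nonneg _ _ _) (Finset.prod_nonneg fun _ _ => P.gen_nonneg ..)

theorem codebookOn_pos (A : Finset V) {q : 𝒬} {u : ∀ v, 𝒰 v} (h : 0 < P.enc q u) :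
    0 < P.codebookOn A q u :=
  mul_pos (marginal_pos P.enc_nonneg _ h) (Finset.prod_pos fun v _ => P.gen_pos h v)

theorem codebookOn_congr {A : Finset V} (hA : ∀ v ∈ A, ∀ w, G.sup v w → w ∈ A) (q : 𝒬)
    {u u' : ∀ v, 𝒰 v} (h : ∀ v ∈ A, u v = u' v) : P.codebookOn A q u = P.codebookOn A q u' := by
  unfold codebookOn
  rw [marginal_empty, marginal_empty]
  congr 1
  refine Finset.prod_congr rfl fun v hv => ?_
  rw [h v hv]
  congr 1
  funext w
  exact h w (hA v hv w w.2)

/-- The codebook factors in `above S` cancel, leaving the relative entropy between the encoding and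
codebook laws of the codewords unaffected by `S`. -/
theorem encodingInfo_sub_mclConditional (S : Finset V) :
    P.encodingInfo - P.mclConditional S = expect P.enc (fun q u =>
      Real.logb 2 (marginal P.enc (G.above S)ᶜ q u / P.codebookOn (G.above S)ᶜ q u)) := by
  unfold encodingInfo mclConditional
  simp_rw [← expect_sub]
  refine expect_congr P.enc_nonneg fun q u h => ?_
  have hm := fun A : Finset V => (marginal_pos P.enc_nonneg A h).ne'
  have hg : ∀ T : Finset V, ∏ v ∈ T, P.gen v q (fun w => u w) (u v) ≠ 0 := fun T =>
    Finset.prod_ne_zero_iff.2 fun v _ => (P.gen_pos h v).ne'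
  rw [codebook, codebookOn, ← Finset.prod_mul_prod_compl (G.above S),
    Real.logb_mul (hm _) (mul_ne_zero (hg _) (hg _)), Real.logb_mul (hg _) (hg _),
    Real.logb_div h.ne' (hm _), Real.logb_div (hm _) (mul_ne_zero (hm _) (hg _)),
    Real.logb_mul (hm _) (hg _)]
  ring

/-- On a set containing all superposition parents of its members, `codebookOn` is a probability law
in those coordinates. This is the normalization that Jensen requires. -/
theorem sum_enc_mul_codebookOn_div_le {A : Finset V} (hA : ∀ v ∈ A, ∀ w, G.sup v w → w ∈ A) :
    ∑ q, ∑ u, P.enc q u * (P.codebookOn A q u / marginal P.enc A q u) ≤ 1 := by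
  obtain ⟨r, hr⟩ := G.exists_rank
  rw [← P.enc_sum]
  refine Finset.sum_le_sum fun q _ => ?_
  rcases isEmpty_or_nonempty (∀ v, 𝒰 v) with hE | ⟨⟨u₀⟩⟩
  · simp
  refine (sum_mul_div_marginal_le P.enc_nonneg A q (P.codebookOn A q)
    (P.codebookOn_nonneg A q) (fun u u' => P.codebookOn_congr hA q) u₀).trans ?_
  have hk := sum_prod_kernel_eq_one (fun v (u : ∀ v, 𝒰 v) => P.gen v q (fun w => u w) (u v)) r
    (fun v u u' h h' => by
      rw [h']
      congr 1
      funext w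
      exact h w (hr v w (Or.inl w.2)))
    (fun v u => by
      rw [← P.gen_sum v q fun w => u w]
      refine Finset.sum_congr rfl fun x _ => ?_
      rw [Function.update_self]
      congr 1
      funext w
      exact Function.update_of_ne (fun h => G.sup_irrefl v (h.subst (motive := G.sup v) w.2)) _ _) A u₀
  simp_rw [codebookOn, marginal_empty, ← mul_ite_zero, ← Finset.mul_sum]
  rw [hk, mul_one]

theorem marginal_eq_codebookOn {S : Finset V} (h : P.encodingInfo - P.mclConditional S ≤ 0)
    {q : 𝒬} {u : ∀ v, 𝒰 v} (hqu : 0 < P.enc q u) :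
    marginal P.enc (G.above S)ᶜ q u = P.codebookOn (G.above S)ᶜ q u := by
  rw [encodingInfo_sub_mclConditional] at h
  have hneg : expect P.enc (fun q u => Real.logb 2
        (marginal P.enc (G.above S)ᶜ q u / P.codebookOn (G.above S)ᶜ q u)) =
      - expect P.enc (fun q u => Real.logb 2
        (P.codebookOn (G.above S)ᶜ q u / marginal P.enc (G.above S)ᶜ q u)) := by
    simp_rw [expect, ← Finset.sum_neg_distrib, ← mul_neg, ← Real.logb_inv, inv_div]
  have := eq_one_of_expect_logb_nonneg P.enc_nonneg P.enc_sum
    (fun q u h => div_pos (P.codebookOn_pos (G.above S)ᶜ h) (marginal_pos P.enc_nonneg _ h))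
    (P.sum_enc_mul_codebookOn_div_le fun v hv w hw => by
      simp only [Finset.mem_compl] at hv ⊢
      exact CGRAS.not_mem_above_of_sup hv hw) (by linarith) hqu
  exact ((div_eq_one_iff_eq (marginal_pos P.enc_nonneg _ hqu).ne').1 this).symm

end CodingLaw

/-! ### Joint law of the codewords selected by two bin index tuples. -/

namespace CodingLaw

variable {V : Type*} [Fintype V] {G : CGRAS V} {𝒬 : Type*} [Fintype 𝒬]
  {𝒰 : V → Type*} [∀ v, Fintype (𝒰 v)] (P : CodingLaw G 𝒬 𝒰)

/-- The conditional probability that the word `x v` is generated for the vertex `v`, given the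
time-sharing sequence and the words on which it is superposed. -/
noncomputable def genWord {N : ℕ} (q : Fin N → 𝒬) (x : ∀ v, Fin N → 𝒰 v) (v : V) : ℝ :=
  ∏ t, P.gen v (q t) (fun u => x u t) (x v t)

theorem sum_prod_gen {N : ℕ} (v : V) (q : Fin N → 𝒬) (a : ∀ u : {u : V // G.sup v u}, Fin N → 𝒰 u) :
    ∑ y : Fin N → 𝒰 v, ∏ t, P.gen v (q t) (fun u => a u t) (y t) = 1 := by
  have := Finset.prod_univ_sum (fun _ : Fin N => (Finset.univ : Finset (𝒰 v)))
    (fun t y => P.gen v (q t) (fun u => a u t) y)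
  rw [Fintype.piFinset_univ] at this
  rw [← this]
  simp [P.gen_sum]

variable {R Rbin : V → ℝ} {N : ℕ}

/-- The set of vertices at which two choices of the bin indices differ. -/
noncomputable def diffSet (b b' : ∀ v, Fin (indexCount N (Rbin v))) : Finset V :=
  Finset.univ.filter fun v => b v ≠ b' v

/-- The codeword of `v` carries the indices of `v` and of everything below it, so it is shared
exactly when none of these bin indices changes. -/
theorem index_eq_iff (m : ∀ v, Fin (indexCount N (R v)))
    (b b' : ∀ v, Fin (indexCount N (Rbin v))) (v : V) :
    (fun u : G.Below v => ((m u, b u) : CodeIndex R Rbin N u)) =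
        (fun u : G.Below v => ((m u, b' u) : CodeIndex R Rbin N u)) ↔
      v ∉ G.above (diffSet b b') := by
  rw [CGRAS.mem_above, funext_iff]
  simp only [diffSet, Finset.mem_filter, Finset.mem_univ, true_and, Prod.mk.injEq]
  constructor
  · rintro h (h' | ⟨u, h', hu⟩)
    · exact h' (h ⟨v, Or.inl rfl⟩)
    · exact h' (h ⟨u, Or.inr hu⟩)
  · intro h u
    push Not at h
    rcases u.2 with hu | hu
    · rw [hu]; exact h.1
    · by_contra hne
      exact h.2 u hne hu

/-- The joint law of the words selected by two choices of the bin indices, for the codebook seen as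
a family over all pairs of a vertex and an index tuple. -/
theorem sum_flatCodebook_pair (q : Fin N → 𝒬) (m : ∀ v, Fin (indexCount N (R v)))
    (b b' : ∀ v, Fin (indexCount N (Rbin v))) (x x' : ∀ v, Fin N → 𝒰 v) :
    (∑ c : ∀ i : Σ v, ∀ u : G.Below v, CodeIndex R Rbin N u, Fin N → 𝒰 i.1,
      if (fun v => c ⟨v, fun u => (m u, b u)⟩) = x ∧ (fun v => c ⟨v, fun u => (m u, b' u)⟩) = x' then
        ∏ i : Σ v, ∀ u : G.Below v, CodeIndex R Rbin N u, ∏ t, P.gen i.1 (q t)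
          (fun u => c ⟨u, restrictIndex G i.2 u⟩ t) (c i t) else 0) =
      if ∀ v ∈ (G.above (diffSet b b'))ᶜ, x' v = x v then
        (∏ v, P.genWord q x v) * ∏ v ∈ G.above (diffSet b b'), P.genWord q x' v else 0 := by
  set lb : ∀ v, ∀ u : G.Below v, CodeIndex R Rbin N u := fun v u => (m u, b u)
  set lb' : ∀ v, ∀ u : G.Below v, CodeIndex R Rbin N u := fun v u => (m u, b' u)
  have hl : ∀ v, lb v = lb' v ↔ v ∉ G.above (diffSet b b') := index_eq_iff m b b'
  split_ifs with hx
  swap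
  · refine Finset.sum_eq_zero fun c _ => if_neg ?_
    rintro ⟨h1, h2⟩
    refine hx fun v hv => ?_
    rw [Finset.mem_compl, ← hl] at hv
    rw [← h1, ← h2]
    change c ⟨v, lb' v⟩ = c ⟨v, lb v⟩
    rw [hv]
  let I := Σ v, ∀ u : G.Below v, CodeIndex R Rbin N u
  let K : I → (∀ i : I, Fin N → 𝒰 i.1) → ℝ := fun i c =>
    ∏ t, P.gen i.1 (q t) (fun u => c ⟨u, restrictIndex G i.2 u⟩ t) (c i t)
  let e : V → I := fun v => ⟨v, lb v⟩
  let e' : V → I := fun v => ⟨v, lb' v⟩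
  have he : Function.Injective e := fun v w h => congrArg Sigma.fst h
  have he' : Function.Injective e' := fun v w h => congrArg Sigma.fst h
  -- `J₁` holds the codebook sites selected by `b`, and `J₂` the additional sites selected by `b'`.
  -- All other sites sum to one, whatever the selected words are.
  let J₁ : Finset I := Finset.univ.map ⟨e, he⟩
  let J₂ : Finset I := (G.above (diffSet b b')).map ⟨e', he'⟩
  have hdisj : Disjoint J₁ J₂ := by
    rw [Finset.disjoint_left]
    intro i h1 h2
    simp only [J₁, J₂, Finset.mem_map, Function.Embedding.coeFn_mk] at h1 h2
    obtain ⟨v, -, rfl⟩ := h1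
    obtain ⟨w, hw, h⟩ := h2
    obtain rfl : w = v := congrArg Sigma.fst h
    have : lb' w = lb w := eq_of_heq (Sigma.mk.inj_iff.1 h).2
    exact (hl w).1 this.symm hw
  have hmem₁ : ∀ v, e v ∈ J₁ ∪ J₂ := fun v =>
    Finset.mem_union_left _ (Finset.mem_map_of_mem _ (Finset.mem_univ v))
  have hmem₂ : ∀ v, e' v ∈ J₁ ∪ J₂ := fun v => by
    by_cases hv : v ∈ G.above (diffSet b b')
    · exact Finset.mem_union_right _ (Finset.mem_map_of_mem ⟨e', he'⟩ hv)
    · have : e' v = e v := by simp only [e, e', (hl v).2 hv]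
      rw [this]; exact hmem₁ v
  let c₀ : ∀ i : I, Fin N → 𝒰 i.1 := fun i => if i.2 = lb i.1 then x i.1 else x' i.1
  have hc₁ : ∀ v, c₀ (e v) = x v := fun v => if_pos rfl
  have hc₂ : ∀ v, c₀ (e' v) = x' v := fun v => by
    by_cases hv : v ∈ G.above (diffSet b b')
    · exact if_neg fun h => (hl v).1 (Eq.symm h) hv
    · exact (if_pos ((hl v).2 hv).symm).trans (hx v (Finset.mem_compl.2 hv)).symm
  have hiff : ∀ c : ∀ i : I, Fin N → 𝒰 i.1,
      ((fun v => c (e v)) = x ∧ (fun v => c (e' v)) = x') ↔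
        ∀ j ∉ (J₁ ∪ J₂)ᶜ, c j = c₀ j := by
    intro c
    constructor
    · rintro ⟨h1, h2⟩ j hj
      rw [Finset.mem_compl, not_not, Finset.mem_union] at hj
      simp only [J₁, J₂, Finset.mem_map, Function.Embedding.coeFn_mk] at hj
      rcases hj with ⟨v, -, rfl⟩ | ⟨v, -, rfl⟩
      · rw [hc₁, ← h1]
      · rw [hc₂, ← h2]
    · intro h
      exact ⟨funext fun v => (h _ (by rw [Finset.mem_compl, not_not]; exact hmem₁ v)).trans (hc₁ v),
        funext fun v => (h _ (by rw [Finset.mem_compl, not_not]; exact hmem₂ v)).trans (hc₂ v)⟩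
  obtain ⟨r, hr⟩ := G.exists_rank
  have hone := sum_prod_kernel_eq_one K (fun i => r i.1)
    (fun i c c' h h' => by
      refine Finset.prod_congr rfl fun t _ => ?_
      rw [h']
      congr 1
      funext u
      rw [h ⟨u, restrictIndex G i.2 u⟩ (hr _ _ (Or.inl u.2))])
    (fun i c => by
      rw [← P.sum_prod_gen i.1 q fun u => c ⟨u, restrictIndex G i.2 u⟩]
      refine Finset.sum_congr rfl fun y _ => Finset.prod_congr rfl fun t _ => ?_
      rw [Function.update_self]
      congr 1
      funext u
      rw [Function.update_of_ne fun h => G.sup_irrefl i.1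
        ((congrArg Sigma.fst h).subst (motive := G.sup i.1) u.2)]) (J₁ ∪ J₂)ᶜ c₀
  calc _ = ∑ c : ∀ i : I, Fin N → 𝒰 i.1, (if ∀ j ∉ (J₁ ∪ J₂)ᶜ, c j = c₀ j then
        ∏ i ∈ (J₁ ∪ J₂)ᶜ, K i c else 0) * ((∏ v, P.genWord q x v) *
          ∏ v ∈ G.above (diffSet b b'), P.genWord q x' v) := by
        refine Finset.sum_congr rfl fun c _ => ?_
        rw [ite_mul, zero_mul]
        refine ite_congr (propext (hiff c)) (fun hc => ?_) fun _ => rfl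
        obtain ⟨h1, h2⟩ := (hiff c).2 hc
        change ∏ i : I, K i c = _
        rw [← Finset.prod_mul_prod_compl (J₁ ∪ J₂), mul_comm, Finset.prod_union hdisj]
        simp only [J₁, J₂, Finset.prod_map, Function.Embedding.coeFn_mk]
        rw [← h1, ← h2]
        rfl
    _ = _ := by
        rw [← Finset.sum_mul]
        refine (congrArg (· * _) ?_).trans (one_mul _)
        convert hone

/-- The joint law of the words selected by two choices of the bin indices. -/
theorem sum_codebook_pair (q : Fin N → 𝒬) (m : ∀ v, Fin (indexCount N (R v)))
    (b b' : ∀ v, Fin (indexCount N (Rbin v)))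
    (F : (∀ v, Fin N → 𝒰 v) → (∀ v, Fin N → 𝒰 v) → ℝ) :
    (∑ c : Codebook G 𝒰 R Rbin N,
      (∏ v, ∏ l : (∀ u : G.Below v, CodeIndex R Rbin N u), ∏ t,
        P.gen v (q t) (fun u => c u (restrictIndex G l u) t) (c v l t)) *
      F (selectedWords c m b) (selectedWords c m b')) =
    ∑ x : ∀ v, Fin N → 𝒰 v, ∑ x' : ∀ v, Fin N → 𝒰 v,
      if ∀ v ∈ (G.above (diffSet b b'))ᶜ, x' v = x v then
        (∏ v, P.genWord q x v) * (∏ v ∈ G.above (diffSet b b'), P.genWord q x' v) * F x x'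
      else 0 := by
  rw [← (Equiv.piCurry fun v (_ : ∀ u : G.Below v, CodeIndex R Rbin N u) =>
    Fin N → 𝒰 v).sum_comp]
  calc _ = ∑ c : ∀ i : Σ v, ∀ u : G.Below v, CodeIndex R Rbin N u, Fin N → 𝒰 i.1,
        ∑ x : ∀ v, Fin N → 𝒰 v, ∑ x' : ∀ v, Fin N → 𝒰 v,
        (if (fun v => c ⟨v, fun u => (m u, b u)⟩) = x ∧
            (fun v => c ⟨v, fun u => (m u, b' u)⟩) = x' then
          ∏ i : Σ v, ∀ u : G.Below v, CodeIndex R Rbin N u, ∏ t, P.gen i.1 (q t)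
            (fun u => c ⟨u, restrictIndex G i.2 u⟩ t) (c i t) else 0) * F x x' := by
        refine Finset.sum_congr rfl fun c _ => ?_
        simp_rw [ite_and, ite_mul, zero_mul]
        simp only [Finset.sum_ite_irrel, Finset.sum_const_zero, Finset.sum_ite_eq, Finset.mem_univ,
          if_true]
        rw [Fintype.prod_sigma]
        rfl
    _ = _ := by
        rw [Finset.sum_comm]
        refine Finset.sum_congr rfl fun x _ => ?_
        rw [Finset.sum_comm]
        refine Finset.sum_congr rfl fun x' _ => ?_
        rw [← Finset.sum_mul, P.sum_flatCodebook_pair q m b b' x x', ite_mul, zero_mul]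

end CodingLaw

/-! ### A law of large numbers via Chebyshev's inequality. -/

section LargeNumbers

variable {Y : Type*} [Fintype Y] {p : Y → ℝ}

theorem sum_prod_word (f : Y → ℝ) (N : ℕ) : ∑ w : Fin N → Y, ∏ t, f (w t) = (∑ y, f y) ^ N := by
  have := Finset.prod_univ_sum (fun _ : Fin N => (Finset.univ : Finset Y)) (fun _ y => f y)
  rw [Fintype.piFinset_univ] at this
  rw [← this]
  simp

theorem sum_word_succ (N : ℕ) (F : (Fin (N + 1) → Y) → ℝ) :
    ∑ w, F w = ∑ y, ∑ w : Fin N → Y, F (Fin.cons y w) := by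
  rw [← (Fin.consEquiv fun _ => Y).sum_comp, Fintype.sum_prod_type]
  rfl

theorem sum_prod_mul_sum {f : Y → ℝ} (hf : ∑ y, p y * f y = 0) (N : ℕ) :
    ∑ w : Fin N → Y, (∏ t, p (w t)) * ∑ t, f (w t) = 0 := by
  induction N with
  | zero => simp
  | succ N ih =>
    rw [sum_word_succ]
    simp only [Fin.prod_univ_succ, Fin.sum_univ_succ, Fin.cons_zero, Fin.cons_succ]
    calc _ = ∑ y, (p y * f y * (∑ w : Fin N → Y, ∏ t, p (w t)) +
          p y * ∑ w : Fin N → Y, (∏ t, p (w t)) * ∑ t, f (w t)) := by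
          refine Finset.sum_congr rfl fun y _ => ?_
          rw [Finset.mul_sum, Finset.mul_sum, ← Finset.sum_add_distrib]
          exact Finset.sum_congr rfl fun w _ => by ring
      _ = 0 := by
          rw [ih]
          simp only [mul_zero, add_zero]
          rw [← Finset.sum_mul, hf, zero_mul]

/-- The variance of a sum of independent centred variables. -/
theorem sum_prod_mul_sum_sq (hp : ∑ y, p y = 1) {f : Y → ℝ} (hf : ∑ y, p y * f y = 0) (N : ℕ) :
    ∑ w : Fin N → Y, (∏ t, p (w t)) * (∑ t, f (w t)) ^ 2 = N * ∑ y, p y * f y ^ 2 := by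
  induction N with
  | zero => simp
  | succ N ih =>
    rw [sum_word_succ]
    simp only [Fin.prod_univ_succ, Fin.sum_univ_succ, Fin.cons_zero, Fin.cons_succ]
    calc _ = ∑ y, (p y * f y ^ 2 * (∑ w : Fin N → Y, ∏ t, p (w t)) +
          2 * (p y * f y) * (∑ w : Fin N → Y, (∏ t, p (w t)) * ∑ t, f (w t)) +
          p y * ∑ w : Fin N → Y, (∏ t, p (w t)) * (∑ t, f (w t)) ^ 2) := by
          refine Finset.sum_congr rfl fun y _ => ?_
          rw [Finset.mul_sum, Finset.mul_sum, Finset.mul_sum, ← Finset.sum_add_distrib,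
            ← Finset.sum_add_distrib]
          exact Finset.sum_congr rfl fun w _ => by ring
      _ = _ := by
          rw [ih, sum_prod_mul_sum hf, sum_prod_word, hp]
          simp only [mul_zero, add_zero, one_pow, mul_one, Finset.sum_add_distrib,
            ← Finset.sum_mul, hp]
          push_cast
          ring

theorem sum_prod_of_count_deviates_le (hp0 : ∀ y, 0 ≤ p y) (hp : ∑ y, p y = 1) {ε : ℝ} (hε : 0 < ε)
    {N : ℕ} (hN : 0 < N) (a : Y) :
    (∑ w : Fin N → Y,
      if |((Finset.univ.filter fun t => w t = a).card : ℝ) / N - p a| ≤ ε * p a then 0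
        else ∏ t, p (w t)) ≤ 1 / (ε * p a) ^ 2 / N := by
  have hNr : (0 : ℝ) < N := by exact_mod_cast hN
  rcases (hp0 a).eq_or_lt with h0 | h0
  · rw [← h0]
    simp only [sub_zero, mul_zero, ne_eq, OfNat.ofNat_ne_zero, not_false_eq_true, zero_pow,
      div_zero, zero_div]
    refine Finset.sum_nonpos fun w _ => ?_
    split_ifs with h
    · rfl
    · by_contra! hw
      refine h ?_
      have : (Finset.univ.filter fun t => w t = a) = ∅ := by
        refine Finset.filter_eq_empty_iff.2 fun t _ ht => hw.ne' ?_
        exact Finset.prod_eq_zero (Finset.mem_univ t) (by rw [ht, ← h0])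
      simp [this]
  · let f : Y → ℝ := fun y => (if y = a then 1 else 0) - p a
    have hf : ∑ y, p y * f y = 0 := by
      simp only [f, mul_sub, Finset.sum_sub_distrib, ← Finset.sum_mul, hp]
      simp
    have hpa : p a ≤ 1 := hp ▸ Finset.single_le_sum (fun y _ => hp0 y) (Finset.mem_univ a)
    have hvar : ∑ y, p y * f y ^ 2 ≤ 1 := by
      rw [← hp]
      refine Finset.sum_le_sum fun y _ => mul_le_of_le_one_right (hp0 y) ?_
      simp only [f]
      split_ifs <;> nlinarith
    have hcount : ∀ w : Fin N → Y, ((Finset.univ.filter fun t => w t = a).card : ℝ) / N - p a =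
        (∑ t, f (w t)) / N := by
      intro w
      simp only [f, Finset.sum_sub_distrib, Finset.sum_boole, Finset.sum_const, Finset.card_univ,
        Fintype.card_fin, nsmul_eq_mul]
      field_simp
    calc _ ≤ ∑ w : Fin N → Y, (∏ t, p (w t)) * (∑ t, f (w t)) ^ 2 * (1 / (N * (ε * p a)) ^ 2) := by
          refine Finset.sum_le_sum fun w _ => ?_
          have hw : 0 ≤ ∏ t, p (w t) := Finset.prod_nonneg fun t _ => hp0 _
          split_ifs with h
          · positivity
          · rw [hcount, not_le, abs_div, Nat.abs_cast, lt_div_iff₀ hNr] at h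
            rw [mul_assoc]
            refine le_mul_of_one_le_right hw ?_
            rw [mul_one_div, one_le_div (by positivity), ← sq_abs (∑ t, f (w t))]
            exact pow_le_pow_left₀ (by positivity) (by linarith) 2
      _ = N * (∑ y, p y * f y ^ 2) * (1 / (N * (ε * p a)) ^ 2) := by
          rw [← Finset.sum_mul, sum_prod_mul_sum_sq hp hf]
      _ ≤ N * 1 * (1 / (N * (ε * p a)) ^ 2) := by gcongr
      _ = _ := by field_simp

/-- The law of large numbers for the relative frequencies of the letters. -/
theorem one_sub_le_sum_prod_of_typical (hp0 : ∀ y, 0 ≤ p y) (hp : ∑ y, p y = 1) {ε : ℝ}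
    (hε : 0 < ε) {N : ℕ} (hN : 0 < N) :
    1 - (∑ a, 1 / (ε * p a) ^ 2) / N ≤ ∑ w : Fin N → Y,
      if ∀ a, |((Finset.univ.filter fun t => w t = a).card : ℝ) / N - p a| ≤ ε * p a then
        ∏ t, p (w t) else 0 := by
  have h1 : ∑ w : Fin N → Y, ∏ t, p (w t) = 1 := by rw [sum_prod_word, hp, one_pow]
  have h2 := Finset.sum_le_sum fun a (_ : a ∈ Finset.univ) =>
    sum_prod_of_count_deviates_le hp0 hp hε hN a
  rw [← Finset.sum_div] at h2
  refine sub_le_comm.1 (le_trans ?_ h2)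
  rw [← h1, ← Finset.sum_sub_distrib, Finset.sum_comm]
  refine Finset.sum_le_sum fun w _ => ?_
  have hw : 0 ≤ ∏ t, p (w t) := Finset.prod_nonneg fun t _ => hp0 _
  split_ifs with h
  · rw [sub_self]
    exact Finset.sum_nonneg fun a _ => by split_ifs; exacts [le_rfl, hw]
  · push Not at h
    obtain ⟨a, ha⟩ := h
    rw [sub_zero]
    refine le_trans ?_ (Finset.single_le_sum (fun a _ => ?_) (Finset.mem_univ a))
    · rw [if_neg ha.not_ge]
    · split_ifs; exacts [le_rfl, hw]

end LargeNumbers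

/-! ### Laws of word tuples and averages over typical words. -/

section Words

variable {V 𝒬 : Type*} {𝒰 : V → Type*} [Fintype V] [Fintype 𝒬] [∀ v, Fintype (𝒰 v)]
  {p : 𝒬 → (∀ v, 𝒰 v) → ℝ} {N : ℕ}

theorem sum_wordTuple (F : (Fin N → ∀ v, 𝒰 v) → ℝ) :
    ∑ x : ∀ v, Fin N → 𝒰 v, F (fun t v => x v t) = ∑ y, F y :=
  (Equiv.piComm fun (v : V) (_ : Fin N) => 𝒰 v).sum_comp F

theorem sum_sum_wordTuple (F : (Fin N → 𝒬 × ∀ v, 𝒰 v) → ℝ) :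
    ∑ q : Fin N → 𝒬, ∑ x : ∀ v, Fin N → 𝒰 v, F (fun t => (q t, fun v => x v t)) = ∑ w, F w := by
  rw [← (Equiv.arrowProdEquivProdArrow (Fin N) (fun _ => 𝒬) fun _ => ∀ v, 𝒰 v).symm.sum_comp,
    Fintype.sum_prod_type]
  exact Finset.sum_congr rfl fun q _ => sum_wordTuple fun y => F fun t => (q t, y t)

/-- The probability of a tuple of words whose letters are drawn independently. -/
noncomputable def wordMass (p : 𝒬 → (∀ v, 𝒰 v) → ℝ) (q : Fin N → 𝒬) (x : ∀ v, Fin N → 𝒰 v) : ℝ :=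
  ∏ t, p (q t) fun v => x v t

omit [Fintype V] [Fintype 𝒬] [∀ v, Fintype (𝒰 v)] in
theorem wordMass_nonneg (hp : ∀ q u, 0 ≤ p q u) (q : Fin N → 𝒬) (x : ∀ v, Fin N → 𝒰 v) :
    0 ≤ wordMass p q x :=
  Finset.prod_nonneg fun _ _ => hp _ _

theorem sum_wordMass (hp1 : ∑ q, ∑ u, p q u = 1) :
    ∑ q : Fin N → 𝒬, ∑ x : ∀ v, Fin N → 𝒰 v, wordMass p q x = 1 := by
  have := sum_sum_wordTuple (N := N) fun w : Fin N → 𝒬 × ∀ v, 𝒰 v => ∏ t, p (w t).1 (w t).2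
  simp only [wordMass]
  rw [this, sum_prod_word fun y : 𝒬 × ∀ v, 𝒰 v => p y.1 y.2, Fintype.sum_prod_type, hp1, one_pow]

theorem one_sub_le_sum_wordMass_of_isTypical (hp : ∀ q u, 0 ≤ p q u)
    (hp1 : ∑ q, ∑ u, p q u = 1) {ε : ℝ} (hε : 0 < ε) (hN : 0 < N) :
    1 - (∑ q, ∑ u, 1 / (ε * p q u) ^ 2) / N ≤
      ∑ q : Fin N → 𝒬, ∑ x : ∀ v, Fin N → 𝒰 v,
        if IsTypical p ε q x then wordMass p q x else 0 := by
  have h := one_sub_le_sum_prod_of_typical (p := fun y : 𝒬 × ∀ v, 𝒰 v => p y.1 y.2)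
    (fun y => hp _ _) (by rw [Fintype.sum_prod_type, hp1]) hε hN
  rw [Fintype.sum_prod_type, ← sum_sum_wordTuple] at h
  refine h.trans_eq (Finset.sum_congr rfl fun q _ => Finset.sum_congr rfl fun x _ => ?_)
  refine if_congr ?_ rfl rfl
  rw [Prod.forall]
  refine forall₂_congr fun a u => ?_
  simp only [Prod.mk.injEq, funext_iff]

omit [Fintype 𝒬] [∀ v, Fintype (𝒰 v)] in
theorem IsTypical.mono (hp : ∀ q u, 0 ≤ p q u) {ε ε' : ℝ} (h : ε ≤ ε') {q : Fin N → 𝒬}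
    {x : ∀ v, Fin N → 𝒰 v} (hx : IsTypical p ε q x) : IsTypical p ε' q x := fun a u =>
  (hx a u).trans (mul_le_mul_of_nonneg_right h (hp a u))

omit [Fintype 𝒬] in
/-- The total probability of the words that agree with `x` on `A`. -/
theorem sum_wordMass_agree (p : 𝒬 → (∀ v, 𝒰 v) → ℝ) (A : Finset V) (q : Fin N → 𝒬)
    (x : ∀ v, Fin N → 𝒰 v) :
    (∑ x' : ∀ v, Fin N → 𝒰 v, if ∀ v ∈ A, x' v = x v then wordMass p q x' else 0) =
      ∏ t, marginal p A (q t) fun v => x v t := by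
  unfold marginal
  have h := Finset.prod_univ_sum (fun _ : Fin N => (Finset.univ : Finset (∀ v, 𝒰 v)))
    (fun t y => if ∀ v ∈ A, y v = x v t then p (q t) y else 0)
  rw [Fintype.piFinset_univ, ← sum_wordTuple] at h
  rw [h]
  refine Finset.sum_congr rfl fun x' _ => ?_
  split_ifs with hA
  · exact Finset.prod_congr rfl fun t _ => (if_pos fun v hv => congrFun (hA v hv) t).symm
  · refine (Finset.prod_eq_zero_iff.2 ?_).symm
    by_contra! hne
    refine hA fun v hv => funext fun t => ?_
    by_contra htv
    exact hne t (Finset.mem_univ t) (if_neg fun hall => htv (hall v hv))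

/-- Averages over the letters of a typical word are close to the expectation. -/
theorem IsTypical.sum_le {ε : ℝ} {q : Fin N → 𝒬} {x : ∀ v, Fin N → 𝒰 v} (hx : IsTypical p ε q x)
    (f : 𝒬 → (∀ v, 𝒰 v) → ℝ) :
    ∑ t, f (q t) (fun v => x v t) ≤
      N * (expect p f + ε * expect p fun a u => |f a u|) := by
  rcases N.eq_zero_or_pos with rfl | hN
  · simp
  have hNr : (0 : ℝ) < N := by exact_mod_cast hN
  calc ∑ t, f (q t) (fun v => x v t)
      = ∑ a, ∑ u, ((Finset.univ.filter fun t : Fin N => q t = a ∧ ∀ v, x v t = u v).card : ℝ) *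
          f a u := by
        simp_rw [← Finset.sum_boole, Finset.sum_mul]
        rw [Finset.sum_congr rfl fun a _ => Finset.sum_comm, Finset.sum_comm]
        refine Finset.sum_congr rfl fun t _ => ?_
        have : ∀ u : ∀ v, 𝒰 v, (∀ v, x v t = u v) ↔ (fun v => x v t) = u := fun u => by
          rw [funext_iff]
        simp only [this, ite_and, ite_mul, one_mul, zero_mul]
        simp
    _ ≤ ∑ a, ∑ u, N * (p a u * f a u + ε * (p a u * |f a u|)) := by
        refine Finset.sum_le_sum fun a _ => Finset.sum_le_sum fun u _ => ?_
        have h := hx a u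
        set k : ℝ := ((Finset.univ.filter fun t : Fin N => q t = a ∧ ∀ v, x v t = u v).card : ℝ)
        have h1 : (k / N - p a u) * f a u ≤ ε * p a u * |f a u| := by
          refine (le_abs_self _).trans ?_
          rw [abs_mul]
          exact mul_le_mul_of_nonneg_right h (abs_nonneg _)
        have h2 : k * f a u = N * (k / N * f a u) := by field_simp
        rw [h2]
        refine mul_le_mul_of_nonneg_left ?_ hNr.le
        linarith
    _ = _ := by
        simp only [expect, ← Finset.mul_sum, Finset.sum_add_distrib]

end Words

/-! ### First and second moments of the weighted count. -/

/-- The second moment method. -/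
theorem sq_sum_le_sum_ite_mul_sum_sq {Ω : Type*} [Fintype Ω] {ω K : Ω → ℝ} (hω : ∀ c, 0 ≤ ω c)
    (E : Ω → Prop) (hE : ∀ c, ¬ E c → K c = 0) :
    (∑ c, ω c * K c) ^ 2 ≤ (∑ c, if E c then ω c else 0) * ∑ c, ω c * K c ^ 2 := by
  refine Finset.sum_sq_le_sum_mul_sum_of_sq_le_mul _ (fun c _ => ?_) (fun c _ => ?_) fun c _ => ?_
  · split_ifs; exacts [hω c, le_rfl]
  · exact mul_nonneg (hω c) (sq_nonneg _)
  · split_ifs with h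
    · exact le_of_eq (by ring)
    · rw [hE c h]; exact le_of_eq (by ring)

namespace CodingLaw

variable {V : Type*} [Fintype V] {G : CGRAS V} {𝒬 : Type*} [Fintype 𝒬]
  {𝒰 : V → Type*} [∀ v, Fintype (𝒰 v)] (P : CodingLaw G 𝒬 𝒰)
  {R Rbin : V → ℝ} {N : ℕ}

theorem wordMass_codebookOn (A : Finset V) (q : Fin N → 𝒬) (x : ∀ v, Fin N → 𝒰 v) :
    wordMass (P.codebookOn A) q x = (∏ t, ∑ u, P.enc (q t) u) * ∏ v ∈ A, P.genWord q x v := by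
  simp only [wordMass, codebookOn, genWord, marginal_empty, Finset.prod_mul_distrib]
  rw [Finset.prod_comm]

theorem enc_pos_of_wordMass_pos {q : Fin N → 𝒬} {x : ∀ v, Fin N → 𝒰 v}
    (h : 0 < wordMass P.enc q x) (t : Fin N) : 0 < P.enc (q t) fun v => x v t :=
  (P.enc_nonneg _ _).lt_of_ne fun h0 =>
    h.ne' (Finset.prod_eq_zero (Finset.mem_univ t) h0.symm)

/-- The likelihood ratio between the encoding and the codebook distribution of a tuple of words,
cut down to the typical ones. -/
noncomputable def typicalRatio (ε : ℝ) (q : Fin N → 𝒬) (x : ∀ v, Fin N → 𝒰 v) : ℝ :=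
  if IsTypical P.enc ε q x then wordMass P.enc q x / wordMass (P.codebookOn Finset.univ) q x else 0

theorem wordMass_codebookOn_mul_typicalRatio (ε : ℝ) (q : Fin N → 𝒬) (x : ∀ v, Fin N → 𝒰 v) :
    wordMass (P.codebookOn Finset.univ) q x * P.typicalRatio ε q x =
      if IsTypical P.enc ε q x then wordMass P.enc q x else 0 := by
  unfold typicalRatio
  split_ifs
  swap
  · simp
  rcases (wordMass_nonneg P.enc_nonneg q x).eq_or_lt with h | h
  · simp [← h]
  · refine mul_div_cancel₀ _ (ne_of_gt ?_)
    exact Finset.prod_pos fun t _ => P.codebookOn_pos _ (P.enc_pos_of_wordMass_pos h t)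

theorem codebookMass_nonneg (q : Fin N → 𝒬) (c : Codebook G 𝒰 R Rbin N) :
    0 ≤ codebookMass P R Rbin N q c :=
  mul_nonneg (Finset.prod_nonneg fun _ _ => Finset.sum_nonneg fun _ _ => P.enc_nonneg _ _)
    (Finset.prod_nonneg fun _ _ => Finset.prod_nonneg fun _ _ => Finset.prod_nonneg fun _ _ =>
      P.gen_nonneg ..)

theorem sum_codebookMass_mul (q : Fin N → 𝒬) (m : ∀ v, Fin (indexCount N (R v)))
    (b b' : ∀ v, Fin (indexCount N (Rbin v)))
    (F : (∀ v, Fin N → 𝒰 v) → (∀ v, Fin N → 𝒰 v) → ℝ) :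
    ∑ c : Codebook G 𝒰 R Rbin N, codebookMass P R Rbin N q c *
      F (selectedWords c m b) (selectedWords c m b') =
    ∑ x : ∀ v, Fin N → 𝒰 v, ∑ x' : ∀ v, Fin N → 𝒰 v,
      if ∀ v ∈ (G.above (diffSet b b'))ᶜ, x' v = x v then
        wordMass (P.codebookOn Finset.univ) q x *
          (∏ v ∈ G.above (diffSet b b'), P.genWord q x' v) * F x x'
      else 0 := by
  simp only [codebookMass, mul_assoc, wordMass_codebookOn]
  rw [← Finset.mul_sum, P.sum_codebook_pair, Finset.mul_sum]
  refine Finset.sum_congr rfl fun x _ => ?_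
  rw [Finset.mul_sum]
  refine Finset.sum_congr rfl fun x' _ => ?_
  rw [mul_ite_zero]
  simp only [mul_assoc]

theorem above_diffSet_self (b : ∀ v, Fin (indexCount N (Rbin v))) :
    G.above (diffSet b b) = ∅ := by
  ext v; simp [CGRAS.mem_above, diffSet]

theorem sum_codebookMass_mul_typicalRatio (ε : ℝ) (q : Fin N → 𝒬)
    (m : ∀ v, Fin (indexCount N (R v))) (b : ∀ v, Fin (indexCount N (Rbin v))) :
    ∑ c : Codebook G 𝒰 R Rbin N, codebookMass P R Rbin N q c *
      P.typicalRatio ε q (selectedWords c m b) =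
    ∑ x : ∀ v, Fin N → 𝒰 v, if IsTypical P.enc ε q x then wordMass P.enc q x else 0 := by
  rw [P.sum_codebookMass_mul q m b b fun x _ => P.typicalRatio ε q x]
  refine Finset.sum_congr rfl fun x _ => ?_
  rw [above_diffSet_self]
  simp_rw [Finset.prod_empty, mul_one, P.wordMass_codebookOn_mul_typicalRatio]
  rw [Finset.sum_eq_single x]
  · exact if_pos fun v _ => rfl
  · intro x' _ hne
    refine if_neg fun h => hne (funext fun v => h v (by simp))
  · simp

/-- The first weight turns the law of `x` into the encoding law. The second cancels the fresh
kernels of `x'`, leaving its encoding mass over the codebook mass of the shared words. Summing over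
`x'` gives the marginal of the shared words, hence the ratio bounded by `B`. -/
theorem sum_codebookMass_mul_typicalRatio_mul_le {ε : ℝ} (q : Fin N → 𝒬)
    (m : ∀ v, Fin (indexCount N (R v))) (b b' : ∀ v, Fin (indexCount N (Rbin v))) {B : ℝ}
    (hB : ∀ x : ∀ v, Fin N → 𝒰 v, IsTypical P.enc ε q x → 0 < wordMass P.enc q x →
      ∏ t, (marginal P.enc (G.above (diffSet b b'))ᶜ (q t) (fun v => x v t) /
        P.codebookOn (G.above (diffSet b b'))ᶜ (q t) (fun v => x v t)) ≤ B) (hB0 : 0 ≤ B) :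
    ∑ c : Codebook G 𝒰 R Rbin N, codebookMass P R Rbin N q c *
      (P.typicalRatio ε q (selectedWords c m b) * P.typicalRatio ε q (selectedWords c m b')) ≤
    B * ∑ x : ∀ v, Fin N → 𝒰 v, wordMass P.enc q x := by
  rw [P.sum_codebookMass_mul q m b b' fun x x' => P.typicalRatio ε q x * P.typicalRatio ε q x',
    Finset.mul_sum]
  refine Finset.sum_le_sum fun x _ => ?_
  set A := G.above (diffSet b b')
  have hx0 := wordMass_nonneg P.enc_nonneg q x
  calc _ ≤ ∑ x' : ∀ v, Fin N → 𝒰 v, if ∀ v ∈ Aᶜ, x' v = x v then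
        (if IsTypical P.enc ε q x then wordMass P.enc q x else 0) *
          (wordMass P.enc q x' / wordMass (P.codebookOn Aᶜ) q x) else 0 := by
        refine Finset.sum_le_sum fun x' _ => ?_
        split_ifs with hag htyp
        rotate_left
        · simp [typicalRatio, htyp]
        · rfl
        have h1 := P.wordMass_codebookOn_mul_typicalRatio ε q x
        rw [if_pos htyp] at h1
        rw [mul_mul_mul_comm, h1]
        refine mul_le_mul_of_nonneg_left ?_ hx0
        have hW : wordMass (P.codebookOn Finset.univ) q x' =
            wordMass (P.codebookOn Aᶜ) q x * ∏ v ∈ A, P.genWord q x' v := by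
          have : wordMass (P.codebookOn Aᶜ) q x = wordMass (P.codebookOn Aᶜ) q x' :=
            Finset.prod_congr rfl fun t _ => P.codebookOn_congr (fun v hv w hw => by
              simp only [Finset.mem_compl] at hv ⊢
              exact CGRAS.not_mem_above_of_sup hv hw) _ fun v hv => congrFun (hag v hv).symm t
          rw [this, wordMass_codebookOn, wordMass_codebookOn, mul_assoc, Finset.prod_compl_mul_prod]
        have hA0 : 0 ≤ wordMass (P.codebookOn Aᶜ) q x := wordMass_nonneg (P.codebookOn_nonneg _) q x
        have hx'0 := wordMass_nonneg P.enc_nonneg q x'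
        unfold typicalRatio
        split_ifs
        swap
        · rw [mul_zero]; positivity
        rw [hW]
        -- If the fresh words have generating probability zero the left side vanishes; otherwise the
        -- common factor cancels.
        by_cases hz : ∏ v ∈ A, P.genWord q x' v = 0
        · rw [hz, zero_mul]; positivity
        · rw [mul_div_assoc', mul_comm (wordMass (P.codebookOn Aᶜ) q x), mul_div_mul_left _ _ hz]
    _ = (if IsTypical P.enc ε q x then wordMass P.enc q x else 0) *
          ∏ t, (marginal P.enc Aᶜ (q t) (fun v => x v t) /
            P.codebookOn Aᶜ (q t) (fun v => x v t)) := by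
        rw [Finset.prod_div_distrib, ← sum_wordMass_agree P.enc Aᶜ q x]
        simp_rw [← mul_ite_zero, ← Finset.mul_sum]
        congr 1
        rw [Finset.sum_div]
        exact Finset.sum_congr rfl fun x' _ => by rw [ite_div, zero_div]; rfl
    _ ≤ _ := by
        split_ifs with htyp
        swap
        · rw [zero_mul]; positivity
        rw [mul_comm]
        rcases hx0.eq_or_lt with h | h
        · simp [← h]
        · exact mul_le_mul_of_nonneg_right (hB x htyp h) hx0

/-- Off `D` the tuple `b'` agrees with `b`, so its values on `D` determine it. -/
theorem card_diffSet_eq_le (b : ∀ v, Fin (indexCount N (Rbin v))) (D : Finset V) :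
    (Finset.univ.filter fun b' : ∀ v, Fin (indexCount N (Rbin v)) => diffSet b b' = D).card ≤
      ∏ v ∈ D, indexCount N (Rbin v) := by
  have hcard : Fintype.card (∀ v : D, Fin (indexCount N (Rbin v))) =
      ∏ v ∈ D, indexCount N (Rbin v) := by
    rw [Fintype.card_pi, ← Finset.prod_coe_sort D]
    simp only [Fintype.card_fin]
  rw [← hcard, ← Finset.card_univ]
  refine Finset.card_le_card_of_injOn (fun b' v => b' v) (fun _ _ => Finset.mem_coe.2
    (Finset.mem_univ _)) fun b₁ h₁ b₂ h₂ h => funext fun v => ?_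
  simp only [Finset.coe_filter, Finset.mem_univ, true_and, Set.mem_ofPred_eq] at h₁ h₂
  by_cases hv : v ∈ D
  · exact congrFun h ⟨v, hv⟩
  · have e₁ : v ∉ diffSet b b₁ := h₁ ▸ hv
    have e₂ : v ∉ diffSet b b₂ := h₂ ▸ hv
    simp only [diffSet, Finset.mem_filter, Finset.mem_univ, true_and, not_not] at e₁ e₂
    exact e₁.symm.trans e₂

/-- A lower bound on the probability of successful encoding, from bounds on the correlation between
the words selected by two choices of the bin indices. -/
theorem sq_le_successProb_mul {ε ε' : ℝ} (hε : ε' ≤ ε) (m : ∀ v, Fin (indexCount N (R v)))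
    (hM : ∀ v, 0 < indexCount N (Rbin v)) (β : Finset V → ℝ) (hβ0 : ∀ D, 0 ≤ β D)
    (hβ : ∀ D, (∃ b b' : ∀ v, Fin (indexCount N (Rbin v)), diffSet b b' = D) →
      ∀ (q : Fin N → 𝒬) (x : ∀ v, Fin N → 𝒰 v), IsTypical P.enc ε' q x → 0 < wordMass P.enc q x →
      ∏ t, (marginal P.enc (G.above D)ᶜ (q t) (fun v => x v t) /
        P.codebookOn (G.above D)ᶜ (q t) (fun v => x v t)) ≤ β D) :
    (∑ q : Fin N → 𝒬, ∑ x : ∀ v, Fin N → 𝒰 v,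
        if IsTypical P.enc ε' q x then wordMass P.enc q x else 0) ^ 2 ≤
      successProb P R Rbin N ε m *
        ∑ D, if ∃ b b' : ∀ v, Fin (indexCount N (Rbin v)), diffSet b b' = D then
          β D / ∏ v ∈ Dᶜ, (indexCount N (Rbin v) : ℝ) else 0 := by
  set M : ℝ := ∏ v, (indexCount N (Rbin v) : ℝ) with hMdef
  have hMpos : 0 < M := Finset.prod_pos fun v _ => by exact_mod_cast hM v
  have hcardB : (Fintype.card (∀ v, Fin (indexCount N (Rbin v))) : ℝ) = M := by
    rw [Fintype.card_pi]; simp [hMdef]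
  let ω : (Fin N → 𝒬) × Codebook G 𝒰 R Rbin N → ℝ := fun z => codebookMass P R Rbin N z.1 z.2
  let φ : (∀ v, Fin (indexCount N (Rbin v))) → (Fin N → 𝒬) × Codebook G 𝒰 R Rbin N → ℝ :=
    fun b z => P.typicalRatio ε' z.1 (selectedWords z.2 m b)
  -- The weights use the smaller parameter `ε'`, while success is only required at `ε`; this frees
  -- `ε'` to be tuned to the slack in the rates.
  have hcs := sq_sum_le_sum_ite_mul_sum_sq (ω := ω) (K := fun z => ∑ b, φ b z)
    (fun z => P.codebookMass_nonneg _ _) (fun z => EncodingSucceeds P ε m z.1 z.2) fun z hz => by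
      refine Finset.sum_eq_zero fun b _ => if_neg fun htyp => hz ⟨b, htyp.mono P.enc_nonneg hε⟩
  have hsucc : (∑ z, if EncodingSucceeds P ε m z.1 z.2 then ω z else 0) =
      successProb P R Rbin N ε m := by
    rw [Fintype.sum_prod_type]; rfl
  set τ := ∑ q : Fin N → 𝒬, ∑ x : ∀ v, Fin N → 𝒰 v,
        if IsTypical P.enc ε' q x then wordMass P.enc q x else 0 with hτ
  have hfirst : ∑ z, ω z * ∑ b, φ b z = M * τ := by
    simp_rw [Finset.mul_sum]
    rw [Finset.sum_comm, ← hcardB, ← Finset.card_univ, ← nsmul_eq_mul, ← Finset.sum_const]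
    refine Finset.sum_congr rfl fun b _ => ?_
    rw [Fintype.sum_prod_type]
    exact Finset.sum_congr rfl fun q _ => P.sum_codebookMass_mul_typicalRatio ε' q m b
  have hsecond : ∑ z, ω z * (∑ b, φ b z) ^ 2 ≤ M ^ 2 *
      ∑ D, if ∃ b b' : ∀ v, Fin (indexCount N (Rbin v)), diffSet b b' = D then
          β D / ∏ v ∈ Dᶜ, (indexCount N (Rbin v) : ℝ) else 0 := by
    calc ∑ z, ω z * (∑ b, φ b z) ^ 2 = ∑ b, ∑ b', ∑ z, ω z * (φ b z * φ b' z) := by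
          simp_rw [sq, Finset.sum_mul_sum, Finset.mul_sum]
          rw [Finset.sum_comm]
          exact Finset.sum_congr rfl fun b _ => Finset.sum_comm
      _ ≤ ∑ b : ∀ v, Fin (indexCount N (Rbin v)), ∑ b', β (diffSet b b') := by
          refine Finset.sum_le_sum fun b _ => Finset.sum_le_sum fun b' _ => ?_
          rw [Fintype.sum_prod_type]
          refine (Finset.sum_le_sum fun q _ => P.sum_codebookMass_mul_typicalRatio_mul_le q m b b'
            (fun x hx hx' => hβ _ ⟨b, b', rfl⟩ q x hx hx') (hβ0 _)).trans_eq ?_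
          rw [← Finset.mul_sum, sum_wordMass P.enc_sum, mul_one]
      _ ≤ ∑ _b : ∀ v, Fin (indexCount N (Rbin v)),
            M * ∑ D, if ∃ b b' : ∀ v, Fin (indexCount N (Rbin v)), diffSet b b' = D then
              β D / ∏ v ∈ Dᶜ, (indexCount N (Rbin v) : ℝ) else 0 := by
          refine Finset.sum_le_sum fun b _ => ?_
          rw [← Finset.sum_fiberwise (s := Finset.univ) (g := fun b' => diffSet b b'),
            Finset.mul_sum]
          refine Finset.sum_le_sum fun D _ => ?_
          split_ifs with hD
          · rw [Finset.sum_congr rfl fun b' hb' => by rw [(Finset.mem_filter.1 hb').2],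
              Finset.sum_const, nsmul_eq_mul]
            have hpos : 0 < ∏ v ∈ Dᶜ, (indexCount N (Rbin v) : ℝ) :=
              Finset.prod_pos fun v _ => by exact_mod_cast hM v
            have : M = (∏ v ∈ D, (indexCount N (Rbin v) : ℝ)) *
              ∏ v ∈ Dᶜ, (indexCount N (Rbin v) : ℝ) := (Finset.prod_mul_prod_compl D _).symm
            rw [this, mul_assoc, mul_div_cancel₀ _ hpos.ne']
            refine mul_le_mul_of_nonneg_right ?_ (hβ0 D)
            exact_mod_cast card_diffSet_eq_le b D
          · rw [mul_zero]
            refine (Finset.sum_eq_zero fun b' hb' => ?_).le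
            exact absurd ⟨b, b', (Finset.mem_filter.1 hb').2⟩ hD
      _ = _ := by
          rw [Finset.sum_const, Finset.card_univ, nsmul_eq_mul, hcardB]
          ring
  rw [hfirst, hsucc] at hcs
  have hs0 : 0 ≤ successProb P R Rbin N ε m := hsucc ▸ Finset.sum_nonneg fun z _ => by
    split_ifs; exacts [P.codebookMass_nonneg _ _, le_rfl]
  have h := hcs.trans (mul_le_mul_of_nonneg_left hsecond hs0)
  rw [mul_pow, mul_left_comm] at h
  exact le_of_mul_le_mul_left h (by positivity)

end CodingLaw

/-! ### Rounding in the number of indices. -/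

section Counting

theorem indexCount_zero_rate (N : ℕ) : indexCount N 0 = 1 := by simp [indexCount]

theorem half_rpow_le_indexCount (N : ℕ) {r : ℝ} (hr : 0 ≤ r) :
    (2 : ℝ) ^ ((N : ℝ) * r) / 2 ≤ indexCount N r := by
  have h1 : (1 : ℝ) ≤ 2 ^ ((N : ℝ) * r) := Real.one_le_rpow one_le_two (by positivity)
  have h2 := Nat.lt_floor_add_one ((2 : ℝ) ^ ((N : ℝ) * r))
  have h3 : (1 : ℝ) ≤ (⌊(2 : ℝ) ^ ((N : ℝ) * r)⌋₊ : ℝ) := by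
    exact_mod_cast (Nat.one_le_floor_iff _).2 h1
  unfold indexCount
  linarith

theorem indexCount_pos (N : ℕ) {r : ℝ} (hr : 0 ≤ r) : 0 < indexCount N r := by
  have h1 : (0 : ℝ) < indexCount N r :=
    lt_of_lt_of_le (by positivity) (half_rpow_le_indexCount N hr)
  exact_mod_cast h1

/-- Rounding down costs at most a factor 2 per vertex, in total the constant `2 ^ Fintype.card V`;
the slack `e` gives the exponential decay. -/
theorem div_prod_indexCount_le {V : Type*} [Fintype V] {r : V → ℝ} (hr : ∀ v, 0 ≤ r v) (N : ℕ)
    (A : Finset V) {a e : ℝ} (h : a + e ≤ ∑ v ∈ A, r v) :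
    (2 : ℝ) ^ ((N : ℝ) * a) / ∏ v ∈ A, (indexCount N (r v) : ℝ) ≤
      2 ^ Fintype.card V * (2 : ℝ) ^ (-((N : ℝ) * e)) := by
  have hprod : (2 : ℝ) ^ ((N : ℝ) * ∑ v ∈ A, r v) / 2 ^ Fintype.card V ≤
      ∏ v ∈ A, (indexCount N (r v) : ℝ) := by
    calc (2 : ℝ) ^ ((N : ℝ) * ∑ v ∈ A, r v) / 2 ^ Fintype.card V
        ≤ (2 : ℝ) ^ ((N : ℝ) * ∑ v ∈ A, r v) / 2 ^ A.card := by
          gcongr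
          · exact one_le_two
          · exact Finset.card_le_univ A
      _ = ∏ v ∈ A, (2 : ℝ) ^ ((N : ℝ) * r v) / 2 := by
          rw [Finset.prod_div_distrib, Finset.prod_const, Finset.mul_sum,
            Real.rpow_sum_of_pos two_pos]
      _ ≤ _ := Finset.prod_le_prod (fun v _ => by positivity) fun v _ =>
          half_rpow_le_indexCount N (hr v)
  rw [div_le_iff₀ (Finset.prod_pos fun v _ => by exact_mod_cast indexCount_pos N (hr v))]
  calc (2 : ℝ) ^ ((N : ℝ) * a) ≤ (2 : ℝ) ^ (-((N : ℝ) * e) + (N : ℝ) * ∑ v ∈ A, r v) := by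
        refine Real.rpow_le_rpow_of_exponent_le one_le_two ?_
        nlinarith [mul_le_mul_of_nonneg_left h (Nat.cast_nonneg (α := ℝ) N)]
    _ = 2 ^ Fintype.card V * (2 : ℝ) ^ (-((N : ℝ) * e)) *
          ((2 : ℝ) ^ ((N : ℝ) * ∑ v ∈ A, r v) / 2 ^ Fintype.card V) := by
        rw [Real.rpow_add two_pos]
        field_simp
    _ ≤ _ := mul_le_mul_of_nonneg_left hprod (by positivity)

end Counting

/-! ### From the rate conditions to the success probability. -/

namespace CodingLaw

variable {V : Type*} [Fintype V] {G : CGRAS V} {𝒬 : Type*} [Fintype 𝒬]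
  {𝒰 : V → Type*} [∀ v, Fintype (𝒰 v)] (P : CodingLaw G 𝒬 𝒰)

/-- The ratio of the encoding and the codebook distribution of the variables whose codewords are
shared by two choices of the bin indices that differ exactly on `D`. -/
noncomputable def sharedRatio (D : Finset V) (q : 𝒬) (u : ∀ v, 𝒰 v) : ℝ :=
  marginal P.enc (G.above D)ᶜ q u / P.codebookOn (G.above D)ᶜ q u

theorem sharedRatio_pos (D : Finset V) {q : 𝒬} {u : ∀ v, 𝒰 v} (h : 0 < P.enc q u) :
    0 < P.sharedRatio D q u :=
  div_pos (marginal_pos P.enc_nonneg _ h) (P.codebookOn_pos _ h)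

theorem prod_sharedRatio_le {N : ℕ} {ε : ℝ} (D : Finset V) {q : Fin N → 𝒬}
    {x : ∀ v, Fin N → 𝒰 v} (hx : IsTypical P.enc ε q x) (hpos : 0 < wordMass P.enc q x) :
    ∏ t, P.sharedRatio D (q t) (fun v => x v t) ≤
      (2 : ℝ) ^ ((N : ℝ) * (expect P.enc (fun a u => Real.logb 2 (P.sharedRatio D a u)) +
        ε * expect P.enc fun a u => |Real.logb 2 (P.sharedRatio D a u)|)) := by
  refine le_trans (le_of_eq ?_) (Real.rpow_le_rpow_of_exponent_le one_le_two
    (hx.sum_le fun a u => Real.logb 2 (P.sharedRatio D a u)))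
  rw [Real.rpow_sum_of_pos two_pos]
  exact Finset.prod_congr rfl fun t _ => (Real.rpow_logb two_pos (by norm_num)
    (P.sharedRatio_pos D (P.enc_pos_of_wordMass_pos hpos t))).symm

section Rates

variable {Rbin : V → ℝ} {mcl : Finset V → ℝ}

theorem encodingInfo_sub_mclConditional_le
    (hmcl : ∀ S, mcl S = P.mclConditional S ∨ mcl S = P.mclRatio S ∨ mcl S = P.mclSum S)
    {S : Finset V} (hS : G.SupClosed S) :
    P.encodingInfo - P.mclConditional S ≤ P.encodingInfo - mcl S := by
  refine sub_le_sub_left ?_ _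
  rcases hmcl S with h | h | h <;> rw [h]
  · exact P.mclRatio_le_mclConditional S
  · exact P.mclSum_le_mclConditional hS

theorem expect_logb_sharedRatio {D : Finset V} (hD : D ⊆ G.binned) :
    expect P.enc (fun a u => Real.logb 2 (P.sharedRatio D a u)) =
      P.encodingInfo - P.mclConditional (G.above D ∩ G.binned) := by
  rw [encodingInfo_sub_mclConditional, CGRAS.above_above_inter_binned hD]
  rfl

variable (hRbin : ∀ v, 0 ≤ Rbin v)
  (hRbin_zero : ∀ v, v ∉ G.binned → Rbin v = 0)
  (hmcl : ∀ S, mcl S = P.mclConditional S ∨ mcl S = P.mclRatio S ∨ mcl S = P.mclSum S)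
  (hrates : ∀ S, G.SupClosed S → 0 < P.encodingInfo - mcl S →
    P.encodingInfo - mcl S < ∑ v ∈ G.binned \ S, Rbin v)

include hRbin hRbin_zero hmcl hrates

/-- If the information difference is nonpositive, the positive rate of `v` outside `D` suffices.
Otherwise the rate hypothesis applies at `G.above D ∩ G.binned`, and the binned vertices outside
that set lie outside `D`. -/
theorem expect_logb_sharedRatio_lt {D : Finset V} (hD : ∀ v ∈ D, 0 < Rbin v) {v : V}
    (hv : v ∉ D) (hv' : 0 < Rbin v) :
    expect P.enc (fun a u => Real.logb 2 (P.sharedRatio D a u)) < ∑ v ∈ Dᶜ, Rbin v := by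
  have hDb : D ⊆ G.binned := fun w hw => by
    by_contra h
    exact (hD w hw).ne' (hRbin_zero w h)
  have hS := CGRAS.supClosed_above_inter_binned (G := G) D
  rw [P.expect_logb_sharedRatio hDb]
  rcases le_or_gt (P.encodingInfo - P.mclConditional (G.above D ∩ G.binned)) 0 with h | h
  · exact h.trans_lt (hv'.trans_le
      (Finset.single_le_sum (f := Rbin) (fun w _ => hRbin w) (Finset.mem_compl.2 hv)))
  · have h1 := P.encodingInfo_sub_mclConditional_le hmcl hS
    refine (h1.trans_lt (hrates _ hS (h.trans_le h1))).trans_le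
      (Finset.sum_le_sum_of_subset_of_nonneg (fun w hw => ?_) fun w _ _ => hRbin w)
    rw [Finset.mem_sdiff] at hw
    exact Finset.mem_compl.2 fun hwD => hw.2
      (Finset.mem_inter.2 ⟨CGRAS.subset_above D hwD, hw.1⟩)

/-- All rate lies in `D`, so a positive right-hand side in the rate condition would have to be less
than zero. The relative entropy of the shared variables is therefore nonpositive, which forces
equality of the two laws on the support. -/
theorem sharedRatio_eq_one {D : Finset V} (hD : ∀ v, v ∈ D ↔ 0 < Rbin v) {q : 𝒬}
    {u : ∀ v, 𝒰 v} (hqu : 0 < P.enc q u) : P.sharedRatio D q u = 1 := by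
  have hDb : D ⊆ G.binned := fun w hw => by
    by_contra h
    exact ((hD w).1 hw).ne' (hRbin_zero w h)
  have hS := CGRAS.supClosed_above_inter_binned (G := G) D
  have hle : P.encodingInfo - mcl (G.above D ∩ G.binned) ≤ 0 := by
    by_contra! h
    refine (h.trans (hrates _ hS h)).ne' (Finset.sum_eq_zero fun w hw => ?_)
    rw [Finset.mem_sdiff] at hw
    refine le_antisymm (not_lt.1 fun hw' => hw.2 ?_) (hRbin w)
    exact Finset.mem_inter.2 ⟨CGRAS.subset_above D ((hD w).2 hw'), hw.1⟩
  have := P.marginal_eq_codebookOn ((P.encodingInfo_sub_mclConditional_le hmcl hS).trans hle) hqu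
  rw [CGRAS.above_above_inter_binned hDb] at this
  rw [sharedRatio, this, div_self (P.codebookOn_pos _ hqu).ne']

/-- At `e = 0` the inequalities are strict; continuity and the finiteness of the family of sets `D`
give one `e` for all. It serves both as typicality parameter and as gap in the exponent. -/
theorem exists_typicality_margin {ε : ℝ} (hε : 0 < ε) : ∃ e, 0 < e ∧ e ≤ ε ∧
    ∀ D : Finset V, (∀ v ∈ D, 0 < Rbin v) → (∃ v, v ∉ D ∧ 0 < Rbin v) →
      expect P.enc (fun a u => Real.logb 2 (P.sharedRatio D a u)) +
        e * expect P.enc (fun a u => |Real.logb 2 (P.sharedRatio D a u)|) + e ≤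
          ∑ v ∈ Dᶜ, Rbin v := by
  have hev : ∀ᶠ e in nhdsWithin (0 : ℝ) (Set.Ioi 0),
      ∀ D : Finset V, (∀ v ∈ D, 0 < Rbin v) → (∃ v, v ∉ D ∧ 0 < Rbin v) →
      expect P.enc (fun a u => Real.logb 2 (P.sharedRatio D a u)) +
        e * expect P.enc (fun a u => |Real.logb 2 (P.sharedRatio D a u)|) + e ≤
          ∑ v ∈ Dᶜ, Rbin v := by
    rw [Filter.eventually_all]
    intro D
    by_cases hD : (∀ v ∈ D, 0 < Rbin v) ∧ ∃ v, v ∉ D ∧ 0 < Rbin v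
    swap
    · exact Filter.Eventually.of_forall fun e h1 h2 => absurd ⟨h1, h2⟩ hD
    obtain ⟨h1, v, h2, h3⟩ := hD
    have hlt := P.expect_logb_sharedRatio_lt hRbin hRbin_zero hmcl hrates h1 h2 h3
    have hcont : Continuous fun e : ℝ =>
        expect P.enc (fun a u => Real.logb 2 (P.sharedRatio D a u)) +
        e * expect P.enc (fun a u => |Real.logb 2 (P.sharedRatio D a u)|) + e := by fun_prop
    have := (hcont.tendsto 0).eventually_lt_const (by simpa using hlt)
    filter_upwards [nhdsWithin_le_nhds this] with e he _ _ using he.le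
  obtain ⟨e, he, h⟩ := (hev.and (Ioc_mem_nhdsGT hε)).exists
  exact ⟨e, h.1, h.2, he⟩

/-- A quantitative form of the achievability of the encoding step. -/
theorem exists_successProb_bound {R : V → ℝ} {ε : ℝ} (hε : 0 < ε) : ∃ e C : ℝ, 0 < e ∧
    ∀ N : ℕ, 0 < N → (0 : ℝ) ≤ 1 - C / N → ∀ m : ∀ v, Fin (indexCount N (R v)),
      (1 - C / N) ^ 2 ≤ successProb P R Rbin N ε m *
        (1 + 2 ^ Fintype.card V * (2 ^ Fintype.card V * (2 : ℝ) ^ (-((N : ℝ) * e)))) := by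
  obtain ⟨e, he, heε, hmargin⟩ :=
    P.exists_typicality_margin hRbin hRbin_zero hmcl hrates hε
  refine ⟨e, ∑ q, ∑ u, 1 / (e * P.enc q u) ^ 2, he, fun N hN hC m => ?_⟩
  have hlln := one_sub_le_sum_wordMass_of_isTypical P.enc_nonneg P.enc_sum he hN
  set Dmax : Finset V := Finset.univ.filter fun v => 0 < Rbin v with hDmax
  have hmem : ∀ v, v ∈ Dmax ↔ 0 < Rbin v := fun v => by simp [hDmax]
  -- An exact bound is needed at `Dmax`: with no spare rate there, even the typicality error in the
  -- exponent could not be absorbed.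
  let β : Finset V → ℝ := fun D => if D = Dmax then 1 else
    (2 : ℝ) ^ ((N : ℝ) * (expect P.enc (fun a u => Real.logb 2 (P.sharedRatio D a u)) +
        e * expect P.enc fun a u => |Real.logb 2 (P.sharedRatio D a u)|))
  have hβ0 : ∀ D, 0 ≤ β D := fun D => by
    simp only [β]; split_ifs <;> positivity
  have hmain := P.sq_le_successProb_mul heε m (fun v => indexCount_pos N (hRbin v)) β hβ0
    fun D _ q x hx hpos => by
      change ∏ t, P.sharedRatio D (q t) (fun v => x v t) ≤ β D
      by_cases hD : D = Dmax
      · rw [show β D = 1 from if_pos hD]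
        refine (Finset.prod_eq_one fun t _ => ?_).le
        exact P.sharedRatio_eq_one hRbin hRbin_zero hmcl hrates (fun v => by rw [hD, hmem])
          (P.enc_pos_of_wordMass_pos hpos t)
      · rw [show β D = _ from if_neg hD]
        exact P.prod_sharedRatio_le D hx hpos
  have hs0 : 0 ≤ successProb P R Rbin N ε m := Finset.sum_nonneg fun q _ =>
    Finset.sum_nonneg fun c _ => by split_ifs; exacts [P.codebookMass_nonneg _ _, le_rfl]
  refine (pow_le_pow_left₀ hC hlln 2).trans (hmain.trans (mul_le_mul_of_nonneg_left ?_ hs0))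
  have hδ : (0 : ℝ) ≤ 2 ^ Fintype.card V * (2 : ℝ) ^ (-((N : ℝ) * e)) := by positivity
  calc _ ≤ ∑ D : Finset V, ((if D = Dmax then (1 : ℝ) else 0) +
        2 ^ Fintype.card V * (2 : ℝ) ^ (-((N : ℝ) * e))) := by
        refine Finset.sum_le_sum fun D _ => ?_
        by_cases hD : D = Dmax
        · rw [if_pos hD, show β D = 1 from if_pos hD]
          have : (1 : ℝ) / ∏ v ∈ Dᶜ, (indexCount N (Rbin v) : ℝ) ≤ 1 := by
            rw [div_le_one (Finset.prod_pos fun v _ => by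
              exact_mod_cast indexCount_pos N (hRbin v))]
            exact_mod_cast Finset.one_le_prod'' fun v : V => indexCount_pos N (hRbin v)
          split_ifs <;> linarith
        · rw [if_neg hD, zero_add]
          split_ifs with hex
          swap
          · exact hδ
          obtain ⟨b, b', rfl⟩ := hex
          -- A vertex of rate zero has a single bin index, so two tuples cannot differ there. Hence
          -- a realizable `D` other than `Dmax` misses a vertex of positive rate.
          have hsub : ∀ v ∈ diffSet b b', 0 < Rbin v := fun v hv => by
            refine (hRbin v).lt_of_ne fun h0 => ?_
            simp only [diffSet, Finset.mem_filter, Finset.mem_univ, true_and] at hv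
            have h1 : indexCount N (Rbin v) = 1 := by rw [← h0, indexCount_zero_rate]
            have := (b v).2
            have := (b' v).2
            exact hv (Fin.ext (by omega))
          have hout : ∃ v, v ∉ diffSet b b' ∧ 0 < Rbin v := by
            by_contra! hno
            refine hD (Finset.ext fun v => ⟨fun hv => (hmem v).2 (hsub v hv), fun hv => ?_⟩)
            by_contra hv'
            exact absurd ((hmem v).1 hv) (hno v hv').not_gt
          rw [show β (diffSet b b') = _ from if_neg hD]
          exact div_prod_indexCount_le hRbin N _ (hmargin _ hsub hout)
    _ = _ := by
        rw [Finset.sum_add_distrib, Finset.sum_ite_eq', if_pos (Finset.mem_univ _),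
          Finset.sum_const, Finset.card_univ, Fintype.card_finset, nsmul_eq_mul]
        push_cast
        ring

end Rates

end CodingLaw

theorem theorem9 {V : Type*} [Fintype V] (G : CGRAS V) {𝒬 : Type*} [Fintype 𝒬]
    {𝒰 : V → Type*} [∀ v, Fintype (𝒰 v)] (P : CodingLaw G 𝒬 𝒰)
    (R Rbin : V → ℝ) (hR : ∀ v, 0 ≤ R v) (hRbin : ∀ v, 0 ≤ Rbin v)
    (hRbin_zero : ∀ v, v ∉ G.binned → Rbin v = 0)
    (mcl : Finset V → ℝ)
    (hmcl : ∀ S, mcl S = P.mclConditional S ∨ mcl S = P.mclRatio S ∨ mcl S = P.mclSum S)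
    (hrates : ∀ S, G.SupClosed S → 0 < P.encodingInfo - mcl S →
      P.encodingInfo - mcl S < ∑ v ∈ G.binned \ S, Rbin v)
    (ε : ℝ) (hε : 0 < ε) :
    ∀ η > 0, ∃ N₀ : ℕ, ∀ N ≥ N₀, ∀ m : ∀ v, Fin (indexCount N (R v)),
      1 - η ≤ successProb P R Rbin N ε m := by
  intro η hη
  obtain ⟨e, C, he, hbound⟩ :=
    P.exists_successProb_bound hRbin hRbin_zero hmcl hrates (R := R) hε
  let δ : ℕ → ℝ := fun N =>
    2 ^ Fintype.card V * (2 ^ Fintype.card V * (2 : ℝ) ^ (-((N : ℝ) * e)))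
  have h1 : Filter.Tendsto (fun N : ℕ => 1 - C / N) Filter.atTop (nhds 1) := by
    simpa using (tendsto_const_div_atTop_nhds_zero_nat C).const_sub 1
  have h2 : Filter.Tendsto δ Filter.atTop (nhds 0) := by
    have hexp : Filter.Tendsto (fun N : ℕ => (2 : ℝ) ^ (-((N : ℝ) * e))) Filter.atTop (nhds 0) := by
      have hlt : (2 : ℝ) ^ (-e) < 1 := Real.rpow_lt_one_of_one_lt_of_neg one_lt_two (by linarith)
      refine (tendsto_pow_atTop_nhds_zero_of_lt_one (by positivity) hlt).congr fun N => ?_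
      rw [← Real.rpow_natCast, ← Real.rpow_mul two_pos.le]
      congr 1
      ring
    simpa [δ] using (hexp.const_mul ((2 : ℝ) ^ Fintype.card V)).const_mul
      ((2 : ℝ) ^ Fintype.card V)
  -- This lower bound for the success probability does not involve the messages, whence the
  -- uniformity in `m`.
  have h3 : Filter.Tendsto (fun N : ℕ => (1 - C / N) ^ 2 / (1 + δ N)) Filter.atTop (nhds 1) := by
    have := (h1.pow 2).div (h2.const_add 1) (by norm_num)
    rwa [one_pow, add_zero, div_one] at this
  have hev := (h3.eventually_const_lt (show 1 - η < 1 by linarith)).and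
    ((h1.eventually_const_lt zero_lt_one).and (Filter.eventually_gt_atTop 0))
  obtain ⟨N₀, hN₀⟩ := Filter.eventually_atTop.1 hev
  refine ⟨N₀, fun N hN m => ?_⟩
  obtain ⟨ha, hb, hc⟩ := hN₀ N hN
  have hδ : 0 < 1 + δ N := by positivity
  exact ha.le.trans ((div_le_iff₀ hδ).2 (hbound N hc hb.le m))
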